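/- **Theorem (Soundness and completeness of binding logic).** Let $\mathcal L$ be a language, that is, a set of function symbols and predicate symbols, each with a binding arity $\langle k_1,\dots,k_n\rangle$ (a finite sequence of natural numbers), and let $\mathcal V$ be an infinite set of variables. *Syntax.* Terms are variables and expressions $f(x^1_1\cdots x^1_{k_1}\,t_1,\dots,x^n_1\cdots x^n_{k_n}\,t_n)$, where $f$ is a function symbol of binding arity $\langle k_1,\dots,k_n\rangle$, the $t_i$ are terms, and the $x^i_j$ are distinct variables, $x^i_1,\dots,x^i_{k_i}$ being bound in $t_i$. Propositions are built from atoms $P(x^1_1\cdots x^1_{k_1}\,t_1,\dots,x^n_1\cdots x^n_{k_n}\,t_n)$, formed in the same way from a predicate symbol $P$, with $\Rightarrow,\wedge,\vee,\bot,\forall x,\exists x$. Terms and propositions are considered up to $\alpha$-equivalence, and $(t/x)A$ denotes capture-avoiding substitution. A sequent $\Gamma\vdash\Delta$ is a pair of finite multisets of propositions; it is *provable* if it is derivable by the rules of the classical sequent calculus (axiom $A\vdash A$, cut, contraction, weakening, the left and right rules of $\Rightarrow,\wedge,\vee,\forall,\exists$, and $\Gamma,\bot\vdash\Delta$), where the premise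 of $\forall$-left and $\exists$-right has $(t/x)A$ for an arbitrary term $t$, and $\forall$-right and $\exists$-left require that $x$ is not free in $\Gamma,\Delta$. *Models.* An intensional functional structure is a family of sets $M_0,M_1,\dots$ with elements $\mathbf 1_n,\dots,\mathbf n_n\in M_n$ and functions $\Box_{p,n}:M_n\times M_p^n\to M_p$ such that $\mathbf i_n\Box\langle a_1,\dots,a_n\rangle=a_i$, $\;a\Box\langle\mathbf 1_n,\dots,\mathbf n_n\rangle=a$, and $(a\Box\langle b_1,\dots,b_n\rangle)\Box c=a\Box\langle b_1\Box c,\dots,b_n\Box c\rangle$ for every tuple $c$. A binding model of $\mathcal L$ is such a structure with $M_0\neq\emptyset$, together with, for each function symbol $f$ of binding arity $\langle k_1,\dots,k_n\rangle$, functions $\hat f_p:\prod_{i=1}^n M_{p+k_i}\to M_p$ $(p\ge 0)$ such that, for all $p,q$, $a_i\in M_{p+k_i}$ and $b\in M_q^p$, $$\hat f_p(a_1,\dots,a_n)\,\Box_{q,p}\, b=\hat f_q\bigl(a_1\Box\Uparrow_{q,k_1,p}(b),\dots,a_n\Box\Uparrow_{q,k_n,p}(b)\bigr),$$ $$\Uparrow_{q,k,p}(b)=\langle\mathbf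 1_{q+k},\dots,\mathbf k_{q+k},b_1\Box S,\dots,b_p\Box S\rangle,\qquad S=\langle(\mathbf{1+k})_{q+k},\dots,(\mathbf{q+k})_{q+k}\rangle,$$ and, for each predicate symbol $P$ of binding arity $\langle k_1,\dots,k_n\rangle$, a function $\hat P:\prod_{i=1}^n M_{k_i}\to\{0,1\}$. *Denotation.* For an assignment $\varphi:\mathcal V\to M_0$ and variables $x_1,\dots,x_p$, the denotation $[\![t]\!]^{x_1,\dots,x_p}_\varphi\in M_p$ of a term is given by: $[\![x]\!]=\mathbf k_p$ if $k$ is the least index with $x_k=x$; $[\![y]\!]=\varphi(y)\,\Box_{p,0}\langle\rangle$ if $y$ is none of the $x_k$; and $[\![f(y^1_1\cdots y^1_{k_1}t_1,\dots,y^n_1\cdots y^n_{k_n}t_n)]\!]=\hat f_p(d_1,\dots,d_n)$ with $d_i=[\![t_i]\!]^{y^i_{k_i},\dots,y^i_1,x_1,\dots,x_p}_\varphi$. An atom $P(y^1_1\cdots y^1_{k_1}t_1,\dots,y^n_1\cdots y^n_{k_n}t_n)$ is true under $\varphi$ if $\hat P(d_1,\dots,d_n)=1$, where $d_i=[\![t_i]\!]^{y^i_{k_i},\dots,y^i_1}_\varphi$;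 the connectives are interpreted classically, and the quantifiers range over $M_0$. A proposition is *valid* in a model if it is true under every assignment; a model of $\Gamma$ is a binding model in which every proposition of $\Gamma$ is valid. Then a sequent $\Gamma\vdash\Delta$ of closed propositions is provable if and only if in every binding model of $\Gamma$ some proposition of $\Delta$ is valid. More generally, a sequent $\Gamma\vdash\Delta$ of arbitrary propositions is provable if and only if, for every binding model and every assignment $\varphi$ under which all propositions of $\Gamma$ are true, some proposition of $\Delta$ is true under $\varphi$. -/

import Mathlib

universe u v w

namespace BindingLogic

/-- A language: function and predicate symbols, each with a binding arity `⟨k₁, …, kₙ⟩`. -/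
structure Language where
  Func : Type u
  Pred : Type u
  funcArity : Func → List ℕ
  predArity : Pred → List ℕ

/-- The binder names `x¹₁ ⋯ x¹ₖ₁, …, xⁿ₁ ⋯ xⁿₖₙ` of one application of a symbol of binding arity
`k`; all of them, over all the arguments, are distinct. -/
structure Binders (k : List ℕ) (V : Type w) where
  name : (i : Fin k.length) → Fin (k.get i) → V
  distinct : Function.Injective fun p : (i : Fin k.length) × Fin (k.get i) => name p.1 p.2

/-- Terms, with named variables in `V`. `app f xs ts` is `f(x¹₁ ⋯ x¹ₖ₁ t₁, …, xⁿ₁ ⋯ xⁿₖₙ tₙ)`. -/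
inductive Term (L : Language.{u}) (V : Type w) : Type (max u w)
  | var (x : V) : Term L V
  | app (f : L.Func) (xs : Binders (L.funcArity f) V)
      (ts : Fin (L.funcArity f).length → Term L V) : Term L V

/-- Propositions. `atom P xs ts` is `P(x¹₁ ⋯ x¹ₖ₁ t₁, …, xⁿ₁ ⋯ xⁿₖₙ tₙ)`. -/
inductive Formula (L : Language.{u}) (V : Type w) : Type (max u w)
  | atom (P : L.Pred) (xs : Binders (L.predArity P) V)
      (ts : Fin (L.predArity P).length → Term L V) : Formula L V
  | imp (A B : Formula L V) : Formula L V
  | and (A B : Formula L V) : Formula L V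
  | or (A B : Formula L V) : Formula L V
  | bot : Formula L V
  | all (x : V) (A : Formula L V) : Formula L V
  | ex (x : V) (A : Formula L V) : Formula L V

section Syntactic

variable {L : Language.{u}} {V : Type w}

/-- The variables that appear, free or bound (binder names included), in a term. -/
def Term.vars : Term L V → Set V
  | .var x => {x}
  | .app _ xs ts => ⋃ i, Set.range (xs.name i) ∪ (ts i).vars

/-- The free variables of a term. -/
def Term.freeVars : Term L V → Set V
  | .var x => {x}
  | .app _ xs ts => ⋃ i, (ts i).freeVars \ Set.range (xs.name i)

/-- The variables that appear, free or bound (binder names included), in a proposition. -/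
def Formula.vars : Formula L V → Set V
  | .atom _ xs ts => ⋃ i, Set.range (xs.name i) ∪ (ts i).vars
  | .imp A B => A.vars ∪ B.vars
  | .and A B => A.vars ∪ B.vars
  | .or A B => A.vars ∪ B.vars
  | .bot => ∅
  | .all x A => {x} ∪ A.vars
  | .ex x A => {x} ∪ A.vars

/-- The free variables of a proposition. -/
def Formula.freeVars : Formula L V → Set V
  | .atom _ xs ts => ⋃ i, (ts i).freeVars \ Set.range (xs.name i)
  | .imp A B => A.freeVars ∪ B.freeVars
  | .and A B => A.freeVars ∪ B.freeVars
  | .or A B => A.freeVars ∪ B.freeVars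
  | .bot => ∅
  | .all x A => A.freeVars \ {x}
  | .ex x A => A.freeVars \ {x}

/-- The map `y₁/x₁, …, yₖ/xₖ`, as a map on all variables that is the identity elsewhere. -/
noncomputable def renameMap {k : ℕ} (ys xs : Fin k → V) : V → Term L V :=
  Function.extend xs (fun j => Term.var (ys j)) Term.var

open scoped Classical in
/-- The restriction of `θ` to the complement of `S`; as maps are total here, it is the identity
on `S`. -/
noncomputable def restrict (S : Set V) (θ : V → Term L V) : V → Term L V :=
  fun z => if z ∈ S then Term.var z else θ z

/-- Grafting `⟨θ⟩t`: replacement of the free variables, with possible captures. -/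
noncomputable def Term.graft (θ : V → Term L V) : Term L V → Term L V
  | .var x => θ x
  | .app f xs ts =>
      .app f xs fun i => Term.graft (restrict (Set.range (xs.name i)) θ) (ts i)

/-- Grafting `⟨θ⟩A` in a proposition. -/
noncomputable def Formula.graft (θ : V → Term L V) : Formula L V → Formula L V
  | .atom P xs ts =>
      .atom P xs fun i => Term.graft (restrict (Set.range (xs.name i)) θ) (ts i)
  | .imp A B => .imp (A.graft θ) (B.graft θ)
  | .and A B => .and (A.graft θ) (B.graft θ)
  | .or A B => .or (A.graft θ) (B.graft θ)
  | .bot => .bot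
  | .all x A => .all x (Formula.graft (restrict {x} θ) A)
  | .ex x A => .ex x (Formula.graft (restrict {x} θ) A)

/-- `α`-equivalence of terms. -/
inductive Term.Alpha : Term L V → Term L V → Prop
  | var (x : V) : Term.Alpha (.var x) (.var x)
  | app (f : L.Func) (xs xs' : Binders (L.funcArity f) V)
      (ts ts' : Fin (L.funcArity f).length → Term L V)
      (ys : (i : Fin (L.funcArity f).length) → Fin ((L.funcArity f).get i) → V)
      (distinct : ∀ i, Function.Injective (ys i))
      (fresh : ∀ i j, ys i j ∉ (ts i).vars ∧ ys i j ∉ (ts' i).vars)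
      (h : ∀ i, Term.Alpha ((ts i).graft (renameMap (ys i) (xs.name i)))
        ((ts' i).graft (renameMap (ys i) (xs'.name i)))) :
      Term.Alpha (.app f xs ts) (.app f xs' ts')

/-- `α`-equivalence of propositions. -/
inductive Formula.Alpha : Formula L V → Formula L V → Prop
  | atom (P : L.Pred) (xs xs' : Binders (L.predArity P) V)
      (ts ts' : Fin (L.predArity P).length → Term L V)
      (ys : (i : Fin (L.predArity P).length) → Fin ((L.predArity P).get i) → V)
      (distinct : ∀ i, Function.Injective (ys i))
      (fresh : ∀ i j, ys i j ∉ (ts i).vars ∧ ys i j ∉ (ts' i).vars)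
      (h : ∀ i, Term.Alpha ((ts i).graft (renameMap (ys i) (xs.name i)))
        ((ts' i).graft (renameMap (ys i) (xs'.name i)))) :
      Formula.Alpha (.atom P xs ts) (.atom P xs' ts')
  | imp {A A' B B' : Formula L V} : Formula.Alpha A A' → Formula.Alpha B B' →
      Formula.Alpha (.imp A B) (.imp A' B')
  | and {A A' B B' : Formula L V} : Formula.Alpha A A' → Formula.Alpha B B' →
      Formula.Alpha (.and A B) (.and A' B')
  | or {A A' B B' : Formula L V} : Formula.Alpha A A' → Formula.Alpha B B' →
      Formula.Alpha (.or A B) (.or A' B')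
  | bot : Formula.Alpha .bot .bot
  | all (x x' y : V) (A A' : Formula L V) (fresh : y ∉ A.vars ∧ y ∉ A'.vars)
      (h : Formula.Alpha (A.graft (renameMap ![y] ![x])) (A'.graft (renameMap ![y] ![x']))) :
      Formula.Alpha (.all x A) (.all x' A')
  | ex (x x' y : V) (A A' : Formula L V) (fresh : y ∉ A.vars ∧ y ∉ A'.vars)
      (h : Formula.Alpha (A.graft (renameMap ![y] ![x])) (A'.graft (renameMap ![y] ![x']))) :
      Formula.Alpha (.ex x A) (.ex x' A')

/-- `Term.IsSubst t x u u'`: the term `u'` is a result of the capture-avoiding substitution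
`(t/x)u`. It is a relation, because the fresh names of the bound variables are arbitrary; the
result is determined up to `α`-equivalence. -/
inductive Term.IsSubst (t : Term L V) (x : V) : Term L V → Term L V → Prop
  | var_self : Term.IsSubst t x (.var x) t
  | var_other (z : V) (h : z ≠ x) : Term.IsSubst t x (.var z) (.var z)
  | app (f : L.Func) (xs ys : Binders (L.funcArity f) V)
      (us us' : Fin (L.funcArity f).length → Term L V)
      (fresh : ∀ i j, ys.name i j ∉ (Term.app f xs us).vars ∧ ys.name i j ∉ t.vars ∧
        ys.name i j ≠ x)
      (h : ∀ i, Term.IsSubst t x ((us i).graft (renameMap (ys.name i) (xs.name i))) (us' i)) :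
      Term.IsSubst t x (.app f xs us) (.app f ys us')

/-- `Formula.IsSubst t x A A'`: the proposition `A'` is a result of the capture-avoiding
substitution `(t/x)A`. -/
inductive Formula.IsSubst (t : Term L V) (x : V) : Formula L V → Formula L V → Prop
  | atom (P : L.Pred) (xs ys : Binders (L.predArity P) V)
      (us us' : Fin (L.predArity P).length → Term L V)
      (fresh : ∀ i j, ys.name i j ∉ (Formula.atom P xs us).vars ∧ ys.name i j ∉ t.vars ∧
        ys.name i j ≠ x)
      (h : ∀ i, Term.IsSubst t x ((us i).graft (renameMap (ys.name i) (xs.name i))) (us' i)) :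
      Formula.IsSubst t x (.atom P xs us) (.atom P ys us')
  | imp {A A' B B' : Formula L V} : Formula.IsSubst t x A A' → Formula.IsSubst t x B B' →
      Formula.IsSubst t x (.imp A B) (.imp A' B')
  | and {A A' B B' : Formula L V} : Formula.IsSubst t x A A' → Formula.IsSubst t x B B' →
      Formula.IsSubst t x (.and A B) (.and A' B')
  | or {A A' B B' : Formula L V} : Formula.IsSubst t x A A' → Formula.IsSubst t x B B' →
      Formula.IsSubst t x (.or A B) (.or A' B')
  | bot : Formula.IsSubst t x .bot .bot
  | all (z y : V) (A A' : Formula L V)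
      (fresh : y ∉ (Formula.all z A).vars ∧ y ∉ t.vars ∧ y ≠ x)
      (h : Formula.IsSubst t x (A.graft (renameMap ![y] ![z])) A') :
      Formula.IsSubst t x (.all z A) (.all y A')
  | ex (z y : V) (A A' : Formula L V)
      (fresh : y ∉ (Formula.ex z A).vars ∧ y ∉ t.vars ∧ y ≠ x)
      (h : Formula.IsSubst t x (A.graft (renameMap ![y] ![z])) A') :
      Formula.IsSubst t x (.ex z A) (.ex y A')

/-- `Provable Γ Δ`: the sequent `Γ ⊢ Δ` has a proof in the sequent calculus of binding logic.
Propositions are considered up to `α`-equivalence, which is what the rule `alpha` says; all the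
other rules are those of predicate logic. -/
inductive Provable : Multiset (Formula L V) → Multiset (Formula L V) → Prop
  | alpha {Γ Γ' Δ Δ' : Multiset (Formula L V)} :
      Multiset.Rel Formula.Alpha Γ Γ' → Multiset.Rel Formula.Alpha Δ Δ' →
      Provable Γ Δ → Provable Γ' Δ'
  | ax (A : Formula L V) : Provable {A} {A}
  | cut {Γ Δ : Multiset (Formula L V)} (A : Formula L V) :
      Provable (A ::ₘ Γ) Δ → Provable Γ (A ::ₘ Δ) → Provable Γ Δ
  | contrLeft {Γ Δ : Multiset (Formula L V)} {A : Formula L V} :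
      Provable (A ::ₘ A ::ₘ Γ) Δ → Provable (A ::ₘ Γ) Δ
  | contrRight {Γ Δ : Multiset (Formula L V)} {A : Formula L V} :
      Provable Γ (A ::ₘ A ::ₘ Δ) → Provable Γ (A ::ₘ Δ)
  | weakLeft {Γ Δ : Multiset (Formula L V)} {A : Formula L V} :
      Provable Γ Δ → Provable (A ::ₘ Γ) Δ
  | weakRight {Γ Δ : Multiset (Formula L V)} {A : Formula L V} :
      Provable Γ Δ → Provable Γ (A ::ₘ Δ)
  | impLeft {Γ Δ : Multiset (Formula L V)} {A B : Formula L V} :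
      Provable Γ (A ::ₘ Δ) → Provable (B ::ₘ Γ) Δ → Provable (.imp A B ::ₘ Γ) Δ
  | impRight {Γ Δ : Multiset (Formula L V)} {A B : Formula L V} :
      Provable (A ::ₘ Γ) (B ::ₘ Δ) → Provable Γ (.imp A B ::ₘ Δ)
  | andLeft {Γ Δ : Multiset (Formula L V)} {A B : Formula L V} :
      Provable (A ::ₘ B ::ₘ Γ) Δ → Provable (.and A B ::ₘ Γ) Δ
  | andRight {Γ Δ : Multiset (Formula L V)} {A B : Formula L V} :
      Provable Γ (A ::ₘ Δ) → Provable Γ (B ::ₘ Δ) → Provable Γ (.and A B ::ₘ Δ)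
  | orLeft {Γ Δ : Multiset (Formula L V)} {A B : Formula L V} :
      Provable (A ::ₘ Γ) Δ → Provable (B ::ₘ Γ) Δ → Provable (.or A B ::ₘ Γ) Δ
  | orRight {Γ Δ : Multiset (Formula L V)} {A B : Formula L V} :
      Provable Γ (A ::ₘ B ::ₘ Δ) → Provable Γ (.or A B ::ₘ Δ)
  | botLeft {Γ Δ : Multiset (Formula L V)} : Provable (.bot ::ₘ Γ) Δ
  | allLeft {Γ Δ : Multiset (Formula L V)} {x : V} {A A' : Formula L V} (t : Term L V) :
      Formula.IsSubst t x A A' → Provable (A' ::ₘ Γ) Δ → Provable (.all x A ::ₘ Γ) Δ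
  | allRight {Γ Δ : Multiset (Formula L V)} {x : V} {A : Formula L V} :
      (∀ B ∈ Γ, x ∉ B.freeVars) → (∀ B ∈ Δ, x ∉ B.freeVars) →
      Provable Γ (A ::ₘ Δ) → Provable Γ (.all x A ::ₘ Δ)
  | exLeft {Γ Δ : Multiset (Formula L V)} {x : V} {A : Formula L V} :
      (∀ B ∈ Γ, x ∉ B.freeVars) → (∀ B ∈ Δ, x ∉ B.freeVars) →
      Provable (A ::ₘ Γ) Δ → Provable (.ex x A ::ₘ Γ) Δ
  | exRight {Γ Δ : Multiset (Formula L V)} {x : V} {A A' : Formula L V} (t : Term L V) :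
      Formula.IsSubst t x A A' → Provable Γ (A' ::ₘ Δ) → Provable Γ (.ex x A ::ₘ Δ)

end Syntactic

/-- Intensional functional structures. `proj i` is the projection `𝐢ₙ` (numbered from `0`) and
`comp a b` is `a □_{p,n} ⟨b₁, …, bₙ⟩`. -/
structure IntensionalStructure where
  carrier : ℕ → Type v
  proj : {n : ℕ} → Fin n → carrier n
  comp : {n p : ℕ} → carrier n → (Fin n → carrier p) → carrier p
  proj_comp : ∀ {n p : ℕ} (i : Fin n) (a : Fin n → carrier p), comp (proj i) a = a i
  comp_proj : ∀ {n : ℕ} (a : carrier n), comp a proj = a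
  comp_assoc : ∀ {n p q : ℕ} (a : carrier n) (b : Fin n → carrier p) (c : Fin p → carrier q),
    comp (comp a b) c = comp a fun i => comp (b i) c

/-- The tuple `⇑_{q,k,p}⟨b₁, …, b_p⟩ = ⟨𝟏, …, 𝐤, b₁ □ S, …, b_p □ S⟩` over `M_{k+q}`, where
`S = ⟨𝐤+𝟏, …, 𝐤+𝐪⟩`. -/
def IntensionalStructure.lift (M : IntensionalStructure.{v}) {p q : ℕ} (k : ℕ)
    (b : Fin p → M.carrier q) : Fin (k + p) → M.carrier (k + q) :=
  Fin.append (fun j : Fin k => M.proj (Fin.castAdd q j))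
    fun j : Fin p => M.comp (b j) fun l : Fin q => M.proj (Fin.natAdd k l)

/-- Binding models of a language: `func f p` is `f̂_p`, and `pred P` is `P̂`. -/
structure BindingModel (L : Language.{u}) extends IntensionalStructure.{v} where
  func : (f : L.Func) → (p : ℕ) →
    ((i : Fin (L.funcArity f).length) → carrier ((L.funcArity f).get i + p)) → carrier p
  func_comp : ∀ (f : L.Func) (p q : ℕ)
    (a : (i : Fin (L.funcArity f).length) → carrier ((L.funcArity f).get i + p))
    (b : Fin p → carrier q),
    comp (func f p a) b =
      func f q fun i => comp (a i) (toIntensionalStructure.lift ((L.funcArity f).get i) b)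
  pred : (P : L.Pred) →
    ((i : Fin (L.predArity P).length) → carrier ((L.predArity P).get i)) → Prop

section Semantics

variable {L : Language.{u}} {V : Type w}

open scoped Classical in
/-- The denotation `⟦t⟧_φ^{x₁, …, x_p}`, an element of `M_p`. A variable that is listed several
times in `x₁, …, x_p` denotes the projection of its first place, which is that of the innermost
binder. -/
noncomputable def BindingModel.termDen (M : BindingModel.{u, v} L) (φ : V → M.carrier 0) :
    Term L V → {p : ℕ} → (Fin p → V) → M.carrier p
  | .var x, _, xs =>
      if h : ∃ j, xs j = x then M.proj (Fin.find (fun j => xs j = x) h)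
      else M.comp (φ x) Fin.elim0
  | .app f ys ts, p, xs =>
      M.func f p fun i => termDen M φ (ts i) (Fin.append (fun j => ys.name i j.rev) xs)

open scoped Classical in
/-- `M.Sat φ A` says `⟦A⟧_φ = 1`. -/
def BindingModel.Sat (M : BindingModel.{u, v} L) (φ : V → M.carrier 0) : Formula L V → Prop
  | .atom P ys ts => M.pred P fun i => M.termDen φ (ts i) fun j => ys.name i j.rev
  | .imp A B => Sat M φ A → Sat M φ B
  | .and A B => Sat M φ A ∧ Sat M φ B
  | .or A B => Sat M φ A ∨ Sat M φ B
  | .bot => False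
  | .all x A => ∀ a : M.carrier 0, Sat M (Function.update φ x a) A
  | .ex x A => ∃ a : M.carrier 0, Sat M (Function.update φ x a) A

/-- A proposition is valid in a model if it is true under every assignment. -/
def BindingModel.Valid (M : BindingModel.{u, v} L) (A : Formula L V) : Prop :=
  ∀ φ : V → M.carrier 0, M.Sat φ A

end Semantics

end BindingLogic

-- Soundness. The list of bound variables in a denotation is traded for an environment `ρ : V →
-- M_p`. Passing under binders sends their names to projections and weakens every other value
-- (`ext`), and the axiom `func_comp` is what makes evaluation commute with composition
-- (`eval_comp`). Hence a grafting without capture is evaluated by changing the environment,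
-- renaming bound variables changes no value (`eval_alpha`, `sat_alpha`), and the substitution
-- `(t/x)` amounts to an update of the environment at `x` (`eval_isSubst`, `sat_isSubst`). Every
-- rule then preserves truth under assignments (`Provable.sound`).
--
-- Completeness is Henkin's argument, with a term model whose level `p` consists of de Bruijn terms
-- with `p` indices and named free variables; composition is parallel substitution for the indices.
-- Two facts tie it to the named syntax. Terms with the same translation are `α`-equivalent
-- (`Term.alpha_of_eval_eq`), which settles atoms. Every de Bruijn term is the value of a named term
-- (`DeBruijn.exists_eval_eq`), so that quantifying over `M_0` is quantifying over terms. An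
-- unprovable sequent is extended to a pair of sets that decides every proposition and contains
-- witnesses (`exists_isHenkin`); the witnesses are variables, of which a finite sequent always
-- leaves some fresh. The pair is satisfied by its term model (`IsHenkin.sat`).
--
-- The extension enumerates the propositions, which therefore must be countable. A sequent involves
-- finitely many symbols and variables, so it comes from a finite sublanguage over a countable set
-- of variables. Derivations travel back along the embedding (`Provable.map`), and the countermodel
-- is expanded to the whole language (`sat_expand`). The version for closed propositions follows
-- because their truth does not depend on the assignment.

universe w'

namespace BindingLogic

/-! ### Evaluation in environments, and soundness. -/

section Environments

variable {L : Language.{u}} {V : Type w}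

theorem Binders.injective {k : List ℕ} (xs : Binders k V) (i : Fin k.length) :
    Function.Injective (xs.name i) := fun a b h => by
  have := @xs.distinct ⟨i, a⟩ ⟨i, b⟩ h
  simpa using this

open scoped Classical in
/-- The extension of an environment under the binders `ys`. -/
noncomputable def BindingModel.ext (M : BindingModel.{u, v} L) {p k : ℕ} (ρ : V → M.carrier p)
    (ys : Fin k → V) : V → M.carrier (k + p) := fun x =>
  if h : ∃ j, ys j = x then M.proj (Fin.castAdd p h.choose.rev)
  else M.comp (ρ x) fun l => M.proj (Fin.natAdd k l)

/-- The value of a term in an environment of level `p`. -/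
noncomputable def BindingModel.eval (M : BindingModel.{u, v} L) :
    Term L V → {p : ℕ} → (V → M.carrier p) → M.carrier p
  | .var x, _, ρ => ρ x
  | .app f ys ts, p, ρ => M.func f p fun i => eval M (ts i) (M.ext ρ (ys.name i))

open scoped Classical in
/-- The environment given by an assignment and a list of variables. -/
noncomputable def BindingModel.env (M : BindingModel.{u, v} L) (φ : V → M.carrier 0) {p : ℕ}
    (xs : Fin p → V) : V → M.carrier p := fun x =>
  if h : ∃ j, xs j = x then M.proj (Fin.find (fun j => xs j = x) h)
  else M.comp (φ x) Fin.elim0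

variable (M : BindingModel.{u, v} L)

/-- The index is reversed because a denotation lists the binders of a scope from the last to the
first. -/
theorem BindingModel.ext_name {p k : ℕ} (ρ : V → M.carrier p) {ys : Fin k → V}
    (hy : Function.Injective ys) (j : Fin k) :
    M.ext ρ ys (ys j) = M.proj (Fin.castAdd p j.rev) := by
  have h : ∃ j', ys j' = ys j := ⟨j, rfl⟩
  rw [BindingModel.ext, dif_pos h, hy h.choose_spec]

theorem BindingModel.ext_of_notMem {p k : ℕ} (ρ : V → M.carrier p) {ys : Fin k → V} {x : V}
    (hx : x ∉ Set.range ys) :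
    M.ext ρ ys x = M.comp (ρ x) fun l => M.proj (Fin.natAdd k l) := by
  rw [BindingModel.ext, dif_neg (show ¬ ∃ j, ys j = x from hx)]

theorem BindingModel.comp_elim0 (a : M.carrier 0) : M.comp a Fin.elim0 = a := by
  conv_rhs => rw [← M.comp_proj a]
  congr 1
  exact Subsingleton.elim _ _

/-- The bridge from lists of variables to environments. A binder name occurs once among the first
`k` places, by injectivity; for any other variable the first occurrence is the one in `xs`, shifted
by `k`, and the shift is the weakening in `ext`. -/
theorem BindingModel.env_append (φ : V → M.carrier 0) {p k : ℕ} (xs : Fin p → V)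
    {ys : Fin k → V} (hy : Function.Injective ys) :
    M.env φ (Fin.append (fun j => ys j.rev) xs) = M.ext (M.env φ xs) ys := by
  classical
  funext x
  by_cases hx : x ∈ Set.range ys
  · obtain ⟨j, rfl⟩ := hx
    rw [M.ext_name _ hy]
    have hj : Fin.append (fun j => ys j.rev) xs (Fin.castAdd p j.rev) = ys j := by simp
    rw [BindingModel.env, dif_pos ⟨_, hj⟩]
    congr 1
    rw [Fin.find_eq_iff]
    refine ⟨hj, fun i hi h => ?_⟩
    induction i using Fin.addCases with
    | left i =>
      rw [Fin.append_left] at h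
      have := hy h
      subst this
      simp at hi
    | right i =>
      have := j.rev.isLt
      simp only [Fin.lt_def, Fin.val_natAdd, Fin.val_castAdd] at hi
      omega
  · rw [M.ext_of_notMem _ hx, BindingModel.env, BindingModel.env]
    have key : ∀ i, Fin.append (fun j => ys j.rev) xs i = x → ∃ l, i = Fin.natAdd k l ∧ xs l = x := by
      intro i h
      induction i using Fin.addCases with
      | left i =>
        rw [Fin.append_left] at h
        exact absurd ⟨_, h⟩ hx
      | right i =>
        rw [Fin.append_right] at h
        exact ⟨i, rfl, h⟩
    by_cases h : ∃ j, xs j = x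
    · have h' : ∃ j, Fin.append (fun j => ys j.rev) xs j = x := by
        obtain ⟨j, hj⟩ := h
        exact ⟨Fin.natAdd k j, by simpa using hj⟩
      rw [dif_pos h, dif_pos h', M.proj_comp]
      congr 1
      rw [Fin.find_eq_iff]
      refine ⟨by simpa using Fin.find_spec h, fun i hi hix => ?_⟩
      obtain ⟨l, rfl, hl⟩ := key i hix
      refine Fin.find_min h ?_ hl
      simpa [Fin.lt_def] using hi
    · have h' : ¬ ∃ j, Fin.append (fun j => ys j.rev) xs j = x := by
        rintro ⟨j, hj⟩
        obtain ⟨l, -, hl⟩ := key j hj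
        exact h ⟨l, hl⟩
      rw [dif_neg h, dif_neg h', M.comp_assoc]
      congr 1
      exact Subsingleton.elim _ _

theorem BindingModel.env_elim0 (φ : V → M.carrier 0) (xs : Fin 0 → V) : M.env φ xs = φ := by
  funext x
  rw [BindingModel.env, dif_neg (fun ⟨j, _⟩ => j.elim0), M.comp_elim0]

theorem BindingModel.termDen_eq_eval (φ : V → M.carrier 0) (t : Term L V) :
    ∀ {p : ℕ} (xs : Fin p → V), M.termDen φ t xs = M.eval t (M.env φ xs) := by
  induction t with
  | var x => intro p xs; rfl
  | app f ys ts ih =>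
    intro p xs
    simp only [BindingModel.termDen, BindingModel.eval]
    congr 1
    funext i
    rw [ih, M.env_append φ xs (ys.injective i)]

theorem BindingModel.sat_atom (φ : V → M.carrier 0) (P : L.Pred) (ys : Binders (L.predArity P) V)
    (ts : Fin (L.predArity P).length → Term L V) :
    M.Sat φ (.atom P ys ts) ↔ M.pred P fun i => M.eval (ts i) (M.ext φ (ys.name i)) := by
  have h : ∀ i, M.termDen φ (ts i) (fun j => ys.name i j.rev) =
      M.eval (ts i) (M.ext φ (ys.name i)) := by
    intro i
    have h1 := M.env_append φ (Fin.elim0 : Fin 0 → V) (ys.injective i)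
    rw [M.env_elim0] at h1
    rw [← h1, M.termDen_eq_eval]
    congr 1
    congr 1
    funext j
    exact (Fin.append_left (fun j => ys.name i j.rev) (Fin.elim0 : Fin 0 → V) j).symm
  rw [BindingModel.Sat]
  exact iff_of_eq (congrArg _ (funext h))

theorem BindingModel.ext_congr {p k : ℕ} {ρ ρ' : V → M.carrier p} {ys : Fin k → V} {x : V}
    (h : x ∉ Set.range ys → ρ x = ρ' x) : M.ext ρ ys x = M.ext ρ' ys x := by
  by_cases hx : x ∈ Set.range ys
  · simp only [BindingModel.ext, dif_pos (show ∃ j, ys j = x from hx)]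
  · rw [M.ext_of_notMem _ hx, M.ext_of_notMem _ hx, h hx]

theorem BindingModel.eval_congr (t : Term L V) : ∀ {p : ℕ} {ρ ρ' : V → M.carrier p},
    (∀ x ∈ t.freeVars, ρ x = ρ' x) → M.eval t ρ = M.eval t ρ' := by
  induction t with
  | var x => intro p ρ ρ' h; exact h x rfl
  | app f ys ts ih =>
    intro p ρ ρ' h
    simp only [BindingModel.eval]
    congr 1
    funext i
    refine ih i fun x hx => M.ext_congr fun hxy => h x ?_
    exact Set.mem_iUnion.2 ⟨i, hx, hxy⟩

theorem BindingModel.ext_comp {p q k : ℕ} (ρ : V → M.carrier p) {ys : Fin k → V}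
    (hy : Function.Injective ys) (b : Fin p → M.carrier q) (x : V) :
    M.comp (M.ext ρ ys x) (M.lift k b) = M.ext (fun z => M.comp (ρ z) b) ys x := by
  by_cases hx : x ∈ Set.range ys
  · obtain ⟨j, rfl⟩ := hx
    rw [M.ext_name _ hy, M.ext_name _ hy, M.proj_comp, IntensionalStructure.lift, Fin.append_left]
  · rw [M.ext_of_notMem _ hx, M.ext_of_notMem _ hx, M.comp_assoc, M.comp_assoc]
    congr 1
    funext l
    rw [M.proj_comp, IntensionalStructure.lift, Fin.append_right]

/-- The case of an application is the axiom `func_comp`, once `ext_comp` has identified composition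
with `lift` under the binders. Weakening, hence all of the substitution theory below, is an
instance. -/
theorem BindingModel.eval_comp (t : Term L V) : ∀ {p q : ℕ} (ρ : V → M.carrier p)
    (b : Fin p → M.carrier q), M.comp (M.eval t ρ) b = M.eval t fun x => M.comp (ρ x) b := by
  induction t with
  | var x => intro p q ρ b; rfl
  | app f ys ts ih =>
    intro p q ρ b
    simp only [BindingModel.eval]
    rw [M.func_comp]
    congr 1
    funext i
    rw [ih]
    congr 1
    funext x
    exact M.ext_comp ρ (ys.injective i) b x

theorem Term.freeVars_subset_vars (t : Term L V) : t.freeVars ⊆ t.vars := by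
  induction t with
  | var x => exact subset_rfl
  | app f ys ts ih =>
    refine Set.iUnion_mono fun i x hx => Or.inr (ih i hx.1)

/-- Outside of the binders `ys`, a term is evaluated in an extended environment by weakening. -/
theorem BindingModel.eval_ext {p k : ℕ} (t : Term L V) (ρ : V → M.carrier p) {ys : Fin k → V}
    (h : ∀ j, ys j ∉ t.freeVars) :
    M.eval t (M.ext ρ ys) = M.comp (M.eval t ρ) fun l => M.proj (Fin.natAdd k l) := by
  rw [M.eval_comp]
  refine M.eval_congr t fun x hx => M.ext_of_notMem _ ?_
  rintro ⟨j, rfl⟩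
  exact h j hx

/-- The map `θ` moves no variable to a term that has a free variable in `S`. -/
def Avoids (θ : V → Term L V) (S : Set V) : Prop :=
  ∀ x, θ x = .var x ∨ ∀ z ∈ (θ x).freeVars, z ∉ S

theorem Avoids.mono {θ : V → Term L V} {S T : Set V} (h : Avoids θ T) (hS : S ⊆ T) :
    Avoids θ S := fun x => (h x).imp_right fun h z hz hzS => h z hz (hS hzS)

theorem Avoids.restrict {θ : V → Term L V} {S : Set V} (h : Avoids θ S) (R : Set V) :
    Avoids (restrict R θ) S := by
  intro x
  by_cases hx : x ∈ R
  · exact Or.inl (if_pos hx)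
  · simpa only [BindingLogic.restrict, if_neg hx] using h x

/-- The passage of a grafting under binders. The names in `ys` are left alone by `restrict`;
elsewhere `Avoids` excludes capture, so `θ x` is merely weakened. -/
theorem BindingModel.eval_restrict {p k : ℕ} {θ : V → Term L V} {S : Set V} {ys : Fin k → V}
    (hy : Function.Injective ys) (h : Avoids θ S) (hS : Set.range ys ⊆ S) (ρ : V → M.carrier p)
    (x : V) : M.eval (restrict (Set.range ys) θ x) (M.ext ρ ys) =
      M.ext (fun z => M.eval (θ z) ρ) ys x := by
  by_cases hx : x ∈ Set.range ys
  · rw [restrict, if_pos hx]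
    obtain ⟨j, rfl⟩ := hx
    rw [M.ext_name _ hy, BindingModel.eval, M.ext_name _ hy]
  · rw [restrict, if_neg hx, M.ext_of_notMem _ hx, M.eval_ext]
    intro j hj
    rcases h x with h | h
    · rw [h] at hj
      exact hx ⟨j, hj⟩
    · exact h _ hj (hS ⟨j, rfl⟩)

theorem BindingModel.eval_graft (t : Term L V) : ∀ {p : ℕ} (ρ : V → M.carrier p)
    {θ : V → Term L V}, Avoids θ t.vars → M.eval (t.graft θ) ρ = M.eval t fun x => M.eval (θ x) ρ := by
  induction t with
  | var x => intro p ρ θ h; rfl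
  | app f ys ts ih =>
    intro p ρ θ h
    simp only [BindingModel.eval, Term.graft]
    congr 1
    funext i
    rw [ih i _ ((h.restrict _).mono fun x hx => Set.mem_iUnion.2 ⟨i, Or.inr hx⟩)]
    congr 1
    funext x
    exact M.eval_restrict (ys.injective i) h
      (fun x hx => Set.mem_iUnion.2 ⟨i, Or.inl hx⟩) ρ x

theorem renameMap_name {k : ℕ} (ys : Fin k → V) {xs : Fin k → V} (hx : Function.Injective xs)
    (j : Fin k) : (renameMap ys xs (xs j) : Term L V) = .var (ys j) :=
  hx.extend_apply _ _ j

theorem renameMap_of_notMem {k : ℕ} (ys : Fin k → V) {xs : Fin k → V} {x : V}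
    (hx : x ∉ Set.range xs) : (renameMap ys xs x : Term L V) = .var x :=
  Function.extend_apply' _ _ _ hx

theorem avoids_renameMap {k : ℕ} {ys xs : Fin k → V} {S : Set V} (hx : Function.Injective xs)
    (h : ∀ j, ys j ∉ S) : Avoids (L := L) (renameMap ys xs) S := by
  intro x
  by_cases hxs : x ∈ Set.range xs
  · obtain ⟨j, rfl⟩ := hxs
    right
    rw [renameMap_name _ hx]
    rintro z rfl
    exact h j
  · exact Or.inl (renameMap_of_notMem _ hxs)

/-- Renaming binders to fresh names does not change the value of the scope. -/
theorem BindingModel.eval_graft_renameMap {p k : ℕ} (t : Term L V) (ρ : V → M.carrier p)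
    {ys xs : Fin k → V} (hy : Function.Injective ys) (hx : Function.Injective xs)
    (h : ∀ j, ys j ∉ t.vars) :
    M.eval (t.graft (renameMap ys xs)) (M.ext ρ ys) = M.eval t (M.ext ρ xs) := by
  rw [M.eval_graft t _ (avoids_renameMap hx h)]
  refine M.eval_congr t fun z hz => ?_
  by_cases hxs : z ∈ Set.range xs
  · obtain ⟨j, rfl⟩ := hxs
    rw [renameMap_name _ hx, BindingModel.eval, M.ext_name _ hy, M.ext_name _ hx]
  · rw [renameMap_of_notMem _ hxs, BindingModel.eval, M.ext_of_notMem _ hxs, M.ext_of_notMem]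
    rintro ⟨j, rfl⟩
    exact h j (t.freeVars_subset_vars hz)

theorem BindingModel.eval_alpha {t t' : Term L V} (h : t.Alpha t') :
    ∀ {p : ℕ} (ρ : V → M.carrier p), M.eval t ρ = M.eval t' ρ := by
  induction h with
  | var x => intro p ρ; rfl
  | app f xs xs' ts ts' ys hy fresh h ih =>
    intro p ρ
    simp only [BindingModel.eval]
    congr 1
    funext i
    -- Both scopes are moved to the common fresh names `ys i`, where the induction hypothesis
    -- compares them.
    rw [← M.eval_graft_renameMap (ts i) ρ (hy i) (xs.injective i) fun j => (fresh i j).1,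
      ← M.eval_graft_renameMap (ts' i) ρ (hy i) (xs'.injective i) fun j => (fresh i j).2, ih]

open scoped Classical in
-- The binder step of the substitution lemma, shared by terms and atoms. Since the fresh names
-- differ from `x` and do not occur in `t`, updating at `x` commutes with extending the environment.
theorem BindingModel.eval_update_graft_renameMap {p k : ℕ} (t u : Term L V) (x : V)
    (ρ : V → M.carrier p) {ys xs : Fin k → V} (hy : Function.Injective ys)
    (hx : Function.Injective xs) (hu : ∀ j, ys j ∉ u.vars) (ht : ∀ j, ys j ∉ t.vars)
    (hne : ∀ j, ys j ≠ x) :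
    M.eval (u.graft (renameMap ys xs))
        (Function.update (M.ext ρ ys) x (M.eval t (M.ext ρ ys))) =
      M.eval u (M.ext (Function.update ρ x (M.eval t ρ)) xs) := by
  rw [← M.eval_graft_renameMap u _ hy hx hu]
  congr 1
  funext z
  by_cases hz : z ∈ Set.range ys
  · obtain ⟨j, rfl⟩ := hz
    rw [Function.update_of_ne (hne j), M.ext_name _ hy, M.ext_name _ hy]
  · rw [M.ext_of_notMem _ hz]
    by_cases hzx : z = x
    · subst hzx
      rw [Function.update_self, Function.update_self, M.eval_ext]
      exact fun j hj => ht j (t.freeVars_subset_vars hj)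
    · rw [Function.update_of_ne hzx, Function.update_of_ne hzx, M.ext_of_notMem _ hz]

open scoped Classical in
theorem BindingModel.eval_isSubst {t : Term L V} {x : V} {u u' : Term L V}
    (h : Term.IsSubst t x u u') : ∀ {p : ℕ} (ρ : V → M.carrier p),
    M.eval u' ρ = M.eval u (Function.update ρ x (M.eval t ρ)) := by
  induction h with
  | var_self => intro p ρ; simp [BindingModel.eval]
  | var_other z h => intro p ρ; simp [BindingModel.eval, h]
  | app f xs ys us us' fresh h ih =>
    intro p ρ
    simp only [BindingModel.eval]
    congr 1
    funext i
    rw [ih, M.eval_update_graft_renameMap t (us i) x ρ (ys.injective i) (xs.injective i)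
      (fun j hj => (fresh i j).1 (Set.mem_iUnion.2 ⟨i, Or.inr hj⟩))
      (fun j => (fresh i j).2.1) (fun j => (fresh i j).2.2)]

theorem Formula.freeVars_subset_vars (A : Formula L V) : A.freeVars ⊆ A.vars := by
  induction A with
  | atom P ys ts =>
    exact Set.iUnion_mono fun i x hx => Or.inr ((ts i).freeVars_subset_vars hx.1)
  | imp A B ihA ihB => exact Set.union_subset_union ihA ihB
  | and A B ihA ihB => exact Set.union_subset_union ihA ihB
  | or A B ihA ihB => exact Set.union_subset_union ihA ihB
  | bot => exact subset_rfl
  | all x A ih => exact fun y hy => Or.inr (ih hy.1)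
  | ex x A ih => exact fun y hy => Or.inr (ih hy.1)

theorem BindingModel.sat_congr (A : Formula L V) : ∀ {φ φ' : V → M.carrier 0},
    (∀ x ∈ A.freeVars, φ x = φ' x) → (M.Sat φ A ↔ M.Sat φ' A) := by
  classical
  have upd : ∀ {x : V} {A : Formula L V} {φ φ' : V → M.carrier 0} (a : M.carrier 0),
      (∀ z ∈ A.freeVars \ {x}, φ z = φ' z) →
      ∀ z ∈ A.freeVars, Function.update φ x a z = Function.update φ' x a z := by
    intro x A φ φ' a h z hz
    by_cases hzx : z = x
    · subst hzx; simp
    · rw [Function.update_of_ne hzx, Function.update_of_ne hzx, h z ⟨hz, hzx⟩]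
  induction A with
  | atom P ys ts =>
    intro φ φ' h
    rw [M.sat_atom, M.sat_atom]
    refine iff_of_eq (congrArg _ (funext fun i => ?_))
    refine M.eval_congr (ts i) fun x hx => M.ext_congr fun hxy => h x ?_
    exact Set.mem_iUnion.2 ⟨i, hx, hxy⟩
  | imp A B ihA ihB =>
    intro φ φ' h
    exact imp_congr (ihA fun x hx => h x (Or.inl hx)) (ihB fun x hx => h x (Or.inr hx))
  | and A B ihA ihB =>
    intro φ φ' h
    exact and_congr (ihA fun x hx => h x (Or.inl hx)) (ihB fun x hx => h x (Or.inr hx))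
  | or A B ihA ihB =>
    intro φ φ' h
    exact or_congr (ihA fun x hx => h x (Or.inl hx)) (ihB fun x hx => h x (Or.inr hx))
  | bot => intro φ φ' h; exact Iff.rfl
  | all x A ih => intro φ φ' h; exact forall_congr' fun a => ih (upd a h)
  | ex x A ih => intro φ φ' h; exact exists_congr fun a => ih (upd a h)

theorem BindingModel.sat_graft (A : Formula L V) : ∀ (φ : V → M.carrier 0) {θ : V → Term L V},
    Avoids θ A.vars → (M.Sat φ (A.graft θ) ↔ M.Sat (fun x => M.eval (θ x) φ) A) := by
  classical
  have upd : ∀ {x : V} {S : Set V} {θ : V → Term L V} (φ : V → M.carrier 0) (a : M.carrier 0),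
      Avoids θ ({x} ∪ S) →
      (fun z => M.eval (restrict {x} θ z) (Function.update φ x a)) =
        Function.update (fun z => M.eval (θ z) φ) x a := by
    intro x S θ φ a h
    funext z
    by_cases hzx : z = x
    · subst hzx
      simp [restrict, BindingModel.eval]
    · rw [Function.update_of_ne hzx, restrict, if_neg (show z ∉ ({x} : Set V) from hzx)]
      refine M.eval_congr _ fun y hy => Function.update_of_ne ?_ _ _
      rintro rfl
      rcases h z with h | h
      · rw [h] at hy
        exact hzx (Set.mem_singleton_iff.1 hy).symm
      · exact h _ hy (Or.inl rfl)
  induction A with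
  | atom P ys ts =>
    intro φ θ h
    rw [Formula.graft, M.sat_atom, M.sat_atom]
    refine iff_of_eq (congrArg _ (funext fun i => ?_))
    rw [M.eval_graft (ts i) _ ((h.restrict _).mono fun x hx => Set.mem_iUnion.2 ⟨i, Or.inr hx⟩)]
    congr 1
    funext x
    exact M.eval_restrict (ys.injective i) h (fun x hx => Set.mem_iUnion.2 ⟨i, Or.inl hx⟩) φ x
  | imp A B ihA ihB =>
    intro φ θ h
    exact imp_congr (ihA φ (h.mono Set.subset_union_left)) (ihB φ (h.mono Set.subset_union_right))
  | and A B ihA ihB =>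
    intro φ θ h
    exact and_congr (ihA φ (h.mono Set.subset_union_left)) (ihB φ (h.mono Set.subset_union_right))
  | or A B ihA ihB =>
    intro φ θ h
    exact or_congr (ihA φ (h.mono Set.subset_union_left)) (ihB φ (h.mono Set.subset_union_right))
  | bot => intro φ θ h; exact Iff.rfl
  | all x A ih =>
    intro φ θ h
    refine forall_congr' fun a => ?_
    rw [ih _ ((h.restrict _).mono Set.subset_union_right), upd φ a h]
  | ex x A ih =>
    intro φ θ h
    refine exists_congr fun a => ?_
    rw [ih _ ((h.restrict _).mono Set.subset_union_right), upd φ a h]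

theorem injective_vec_one (x : V) : Function.Injective ![x] := fun a b _ => Subsingleton.elim a b

theorem renameMap_vec_self (y x : V) : (renameMap ![y] ![x] x : Term L V) = .var y :=
  renameMap_name ![y] (injective_vec_one x) 0

theorem renameMap_vec_of_ne (y : V) {x z : V} (h : z ≠ x) :
    (renameMap ![y] ![x] z : Term L V) = .var z :=
  renameMap_of_notMem _ (by simpa using h)

open scoped Classical in
theorem BindingModel.sat_graft_renameMap (A : Formula L V) (φ : V → M.carrier 0) {x y : V}
    (h : y ∉ A.vars) : M.Sat φ (A.graft (renameMap ![y] ![x])) ↔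
      M.Sat (Function.update φ x (φ y)) A := by
  rw [M.sat_graft A φ (avoids_renameMap (injective_vec_one x) (by simpa using h))]
  refine iff_of_eq (congrArg (fun ψ => M.Sat ψ A) (funext fun z => ?_))
  by_cases hz : z = x
  · subst hz
    rw [renameMap_vec_self, Function.update_self, BindingModel.eval]
  · rw [renameMap_vec_of_ne y hz, Function.update_of_ne hz, BindingModel.eval]

open scoped Classical in
theorem BindingModel.sat_update_graft_renameMap (A : Formula L V) (φ : V → M.carrier 0) {x y : V}
    (h : y ∉ A.vars) (a : M.carrier 0) :
    M.Sat (Function.update φ y a) (A.graft (renameMap ![y] ![x])) ↔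
      M.Sat (Function.update φ x a) A := by
  rw [M.sat_graft_renameMap A _ h, Function.update_self]
  refine M.sat_congr A fun z hz => ?_
  have hzy : z ≠ y := fun e => h (e ▸ A.freeVars_subset_vars hz)
  by_cases hzx : z = x
  · subst hzx; simp
  · rw [Function.update_of_ne hzx, Function.update_of_ne hzx, Function.update_of_ne hzy]

theorem BindingModel.sat_alpha {A A' : Formula L V} (h : A.Alpha A') :
    ∀ (φ : V → M.carrier 0), M.Sat φ A ↔ M.Sat φ A' := by
  classical
  induction h with
  | atom P xs xs' ts ts' ys hy fresh h =>
    intro φ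
    rw [M.sat_atom, M.sat_atom]
    refine iff_of_eq (congrArg _ (funext fun i => ?_))
    rw [← M.eval_graft_renameMap (ts i) φ (hy i) (xs.injective i) fun j => (fresh i j).1,
      ← M.eval_graft_renameMap (ts' i) φ (hy i) (xs'.injective i) fun j => (fresh i j).2,
      M.eval_alpha (h i)]
  | imp _ _ ihA ihB => exact fun φ => imp_congr (ihA φ) (ihB φ)
  | and _ _ ihA ihB => exact fun φ => and_congr (ihA φ) (ihB φ)
  | or _ _ ihA ihB => exact fun φ => or_congr (ihA φ) (ihB φ)
  | bot => exact fun φ => Iff.rfl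
  | all x x' y A A' fresh h ih =>
    refine fun φ => forall_congr' fun a => ?_
    rw [← M.sat_update_graft_renameMap A φ fresh.1 a, ih,
      M.sat_update_graft_renameMap A' φ fresh.2 a]
  | ex x x' y A A' fresh h ih =>
    refine fun φ => exists_congr fun a => ?_
    rw [← M.sat_update_graft_renameMap A φ fresh.1 a, ih,
      M.sat_update_graft_renameMap A' φ fresh.2 a]

open scoped Classical in
theorem BindingModel.sat_isSubst {t : Term L V} {x : V} {A A' : Formula L V}
    (h : Formula.IsSubst t x A A') : ∀ φ : V → M.carrier 0,
    M.Sat φ A' ↔ M.Sat (Function.update φ x (M.eval t φ)) A := by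
  -- The quantifier step: the value of `t` ignores the update at the fresh `y`, the updates at `x`
  -- and `y` commute, and the renaming of `z` to `y` is undone by updating `z` instead.
  have quant : ∀ {z y : V} {A : Formula L V} (φ : V → M.carrier 0) (a : M.carrier 0),
      y ∉ {z} ∪ A.vars → y ∉ t.vars → y ≠ x →
      (M.Sat (Function.update (Function.update φ y a) x (M.eval t (Function.update φ y a)))
        (A.graft (renameMap ![y] ![z])) ↔
      M.Sat (Function.update (Function.update φ x (M.eval t φ)) z a) A) := by
    intro z y A φ a hyA hyt hyx
    have : M.eval t (Function.update φ y a) = M.eval t φ :=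
      M.eval_congr t fun w hw => Function.update_of_ne
        (fun e : w = y => hyt (e ▸ t.freeVars_subset_vars hw)) _ _
    rw [this, Function.update_comm hyx, M.sat_update_graft_renameMap A _ fun h => hyA (Or.inr h)]
  induction h with
  | atom P xs ys us us' fresh h =>
    intro φ
    rw [M.sat_atom, M.sat_atom]
    refine iff_of_eq (congrArg _ (funext fun i => ?_))
    rw [M.eval_isSubst (h i), M.eval_update_graft_renameMap t (us i) x φ (ys.injective i)
      (xs.injective i) (fun j hj => (fresh i j).1 (Set.mem_iUnion.2 ⟨i, Or.inr hj⟩))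
      (fun j => (fresh i j).2.1) (fun j => (fresh i j).2.2)]
  | imp _ _ ihA ihB => exact fun φ => imp_congr (ihA φ) (ihB φ)
  | and _ _ ihA ihB => exact fun φ => and_congr (ihA φ) (ihB φ)
  | or _ _ ihA ihB => exact fun φ => or_congr (ihA φ) (ihB φ)
  | bot => exact fun φ => Iff.rfl
  | all z y A A' fresh h ih =>
    intro φ
    refine forall_congr' fun a => ?_
    rw [ih, quant φ a fresh.1 fresh.2.1 fresh.2.2]
  | ex z y A A' fresh h ih =>
    intro φ
    refine exists_congr fun a => ?_
    rw [ih, quant φ a fresh.1 fresh.2.1 fresh.2.2]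

theorem BindingModel.sat_of_rel_alpha {Γ Γ' : Multiset (Formula L V)}
    (h : Multiset.Rel Formula.Alpha Γ Γ') (φ : V → M.carrier 0) :
    ((∀ A ∈ Γ, M.Sat φ A) ↔ ∀ A ∈ Γ', M.Sat φ A) ∧
      ((∃ A ∈ Γ, M.Sat φ A) ↔ ∃ A ∈ Γ', M.Sat φ A) := by
  induction h with
  | zero => simp
  | cons hA _ ih => simp [ih, M.sat_alpha hA φ]

theorem Provable.sound {Γ Δ : Multiset (Formula L V)} (h : Provable Γ Δ) :
    ∀ φ : V → M.carrier 0, (∀ A ∈ Γ, M.Sat φ A) → ∃ B ∈ Δ, M.Sat φ B := by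
  classical
  -- The semantic content of the eigenvariable condition.
  have fresh : ∀ {Γ : Multiset (Formula L V)} {x : V}, (∀ B ∈ Γ, x ∉ B.freeVars) →
      ∀ (φ : V → M.carrier 0) (a : M.carrier 0), ∀ B ∈ Γ,
        (M.Sat (Function.update φ x a) B ↔ M.Sat φ B) := fun {_ x} h φ a B hB =>
    M.sat_congr B fun z hz => Function.update_of_ne (fun e : z = x => h B hB (e ▸ hz)) _ _
  induction h with
  | alpha hΓ hΔ _ ih =>
    intro φ h
    exact (M.sat_of_rel_alpha hΔ φ).2.1 (ih φ ((M.sat_of_rel_alpha hΓ φ).1.2 h))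
  | ax A => intro φ h; exact ⟨A, by simp, h A (by simp)⟩
  | cut A _ _ ih₁ ih₂ =>
    intro φ h
    obtain ⟨B, hB, hs⟩ := ih₂ φ h
    rcases Multiset.mem_cons.1 hB with rfl | hB
    · exact ih₁ φ (by simpa [hs] using h)
    · exact ⟨B, hB, hs⟩
  | contrLeft _ ih => intro φ h; exact ih φ (by simpa using h)
  | contrRight _ ih => intro φ h; simpa using ih φ h
  | weakLeft _ ih => intro φ h; exact ih φ fun A hA => h A (Multiset.mem_cons_of_mem hA)
  | weakRight _ ih =>
    intro φ h
    obtain ⟨B, hB, hs⟩ := ih φ h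
    exact ⟨B, Multiset.mem_cons_of_mem hB, hs⟩
  | impLeft _ _ ih₁ ih₂ =>
    intro φ h
    simp only [Multiset.mem_cons, forall_eq_or_imp, BindingModel.Sat, exists_eq_or_imp] at *
    rcases ih₁ φ h.2 with hA | hB
    · exact ih₂ φ ⟨h.1 hA, h.2⟩
    · exact hB
  | impRight _ ih =>
    intro φ h
    simp only [Multiset.mem_cons, forall_eq_or_imp, BindingModel.Sat, exists_eq_or_imp] at *
    by_contra! hc
    rcases ih φ ⟨hc.1.1, h⟩ with hB | ⟨B, hB, hs⟩
    · exact hc.1.2 hB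
    · exact hc.2 B hB hs
  | andLeft _ ih =>
    intro φ h
    simp only [Multiset.mem_cons, forall_eq_or_imp, BindingModel.Sat] at *
    exact ih φ ⟨h.1.1, h.1.2, h.2⟩
  | andRight _ _ ih₁ ih₂ =>
    intro φ h
    simp only [Multiset.mem_cons, BindingModel.Sat, exists_eq_or_imp] at *
    rcases ih₁ φ h with hA | hA
    · rcases ih₂ φ h with hB | hB
      · exact Or.inl ⟨hA, hB⟩
      · exact Or.inr hB
    · exact Or.inr hA
  | orLeft _ _ ih₁ ih₂ =>
    intro φ h
    simp only [Multiset.mem_cons, forall_eq_or_imp, BindingModel.Sat] at *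
    rcases h.1 with hA | hB
    · exact ih₁ φ ⟨hA, h.2⟩
    · exact ih₂ φ ⟨hB, h.2⟩
  | orRight _ ih =>
    intro φ h
    simp only [Multiset.mem_cons, BindingModel.Sat, exists_eq_or_imp] at *
    rw [or_assoc]
    exact ih φ h
  | botLeft => intro φ h; exact (h .bot (by simp)).elim
  | allLeft t hs _ ih =>
    intro φ h
    refine ih φ fun B hB => ?_
    rcases Multiset.mem_cons.1 hB with rfl | hB
    · exact (M.sat_isSubst hs φ).2 (h (.all _ _) (Multiset.mem_cons_self _ _) _)
    · exact h B (Multiset.mem_cons_of_mem hB)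
  | @allRight Γ Δ x A hΓ hΔ _ ih =>
    intro φ h
    -- The true proposition supplied by the premise may depend on `a`. Once no proposition of `Δ` is
    -- true, it has to be `A` for every `a`.
    by_cases hc : ∃ B ∈ Δ, M.Sat φ B
    · obtain ⟨B, hB, hs⟩ := hc
      exact ⟨B, Multiset.mem_cons_of_mem hB, hs⟩
    · refine ⟨.all x A, Multiset.mem_cons_self _ _, fun a => ?_⟩
      obtain ⟨B, hB, hs⟩ := ih (Function.update φ x a) fun B hB => (fresh hΓ φ a B hB).2 (h B hB)
      rcases Multiset.mem_cons.1 hB with rfl | hB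
      · exact hs
      · exact absurd ⟨B, hB, (fresh hΔ φ a B hB).1 hs⟩ hc
  | @exLeft Γ Δ x A hΓ hΔ _ ih =>
    intro φ h
    obtain ⟨a, ha⟩ := h (.ex x A) (Multiset.mem_cons_self _ _)
    obtain ⟨B, hB, hs⟩ := ih (Function.update φ x a) fun B hB => by
      rcases Multiset.mem_cons.1 hB with rfl | hB
      · exact ha
      · exact (fresh hΓ φ a B hB).2 (h B (Multiset.mem_cons_of_mem hB))
    exact ⟨B, hB, (fresh hΔ φ a B hB).1 hs⟩
  | exRight t hs _ ih =>
    intro φ h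
    obtain ⟨B, hB, hsat⟩ := ih φ h
    rcases Multiset.mem_cons.1 hB with rfl | hB
    · exact ⟨_, Multiset.mem_cons_self _ _, _, (M.sat_isSubst hs φ).1 hsat⟩
    · exact ⟨B, Multiset.mem_cons_of_mem hB, hsat⟩

end Environments

/-! ### De Bruijn terms and the term model. -/

/-- Terms with de Bruijn indices below `n` for the bound variables and names for the free ones. -/
inductive DeBruijn (L : Language.{u}) (V : Type w) : ℕ → Type (max u w)
  | free {n : ℕ} (x : V) : DeBruijn L V n
  | bound {n : ℕ} (i : Fin n) : DeBruijn L V n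
  | app {n : ℕ} (f : L.Func)
      (ts : (i : Fin (L.funcArity f).length) → DeBruijn L V ((L.funcArity f).get i + n)) :
      DeBruijn L V n

namespace DeBruijn

variable {L : Language.{u}} {V : Type w}

/-- The extension of a map of indices under `k` binders. -/
def liftIndex {n p : ℕ} (k : ℕ) (r : Fin n → Fin p) : Fin (k + n) → Fin (k + p) :=
  Fin.append (Fin.castAdd p) fun j => Fin.natAdd k (r j)

/-- Renaming of the indices. -/
def rename : {n : ℕ} → DeBruijn L V n → {p : ℕ} → (Fin n → Fin p) → DeBruijn L V p
  | _, free x, _, _ => free x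
  | _, bound i, _, r => bound (r i)
  | _, app f ts, _, r => app f fun i => (ts i).rename (liftIndex _ r)

/-- The extension of a substitution under `k` binders. -/
def liftSubst {n p : ℕ} (k : ℕ) (σ : Fin n → DeBruijn L V p) : Fin (k + n) → DeBruijn L V (k + p) :=
  Fin.append (fun j => bound (Fin.castAdd p j)) fun j => (σ j).rename (Fin.natAdd k)

/-- Parallel substitution for the indices. -/
def subst : {n : ℕ} → DeBruijn L V n → {p : ℕ} → (Fin n → DeBruijn L V p) → DeBruijn L V p
  | _, free x, _, _ => free x
  | _, bound i, _, σ => σ i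
  | _, app f ts, _, σ => app f fun i => (ts i).subst (liftSubst _ σ)

theorem liftSubst_bound {n p : ℕ} (k : ℕ) (r : Fin n → Fin p) :
    liftSubst (L := L) (V := V) k (fun j => bound (r j)) = fun j => bound (liftIndex k r j) := by
  funext j
  induction j using Fin.addCases <;> simp [liftSubst, liftIndex, rename]

theorem rename_eq_subst {n : ℕ} (t : DeBruijn L V n) : ∀ {p : ℕ} (r : Fin n → Fin p),
    t.rename r = t.subst fun j => bound (r j) := by
  induction t with
  | free x => intro p r; rfl
  | bound i => intro p r; rfl
  | app f ts ih =>
    intro p r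
    simp only [rename, subst, liftSubst_bound, ih]

/-- The first of the composition laws, as its inductive step needs none of the others. It yields
`rename_rename`, which yields `rename_subst`; the two mixed laws give `liftSubst_subst`, the
inductive step of `subst_subst`. -/
theorem subst_rename {n : ℕ} (t : DeBruijn L V n) : ∀ {p q : ℕ} (r : Fin n → Fin p)
    (τ : Fin p → DeBruijn L V q), (t.rename r).subst τ = t.subst fun j => τ (r j) := by
  induction t with
  | free x => intro p q r τ; rfl
  | bound i => intro p q r τ; rfl
  | app f ts ih =>
    intro p q r τ
    simp only [rename, subst, ih]
    congr 1
    funext i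
    congr 1
    funext j
    induction j using Fin.addCases <;> simp [liftSubst, liftIndex]

theorem rename_rename {n : ℕ} (t : DeBruijn L V n) {p q : ℕ} (r : Fin n → Fin p)
    (s : Fin p → Fin q) : (t.rename r).rename s = t.rename fun j => s (r j) := by
  rw [rename_eq_subst _ s, subst_rename, ← rename_eq_subst]

theorem rename_subst {n : ℕ} (t : DeBruijn L V n) : ∀ {p q : ℕ} (σ : Fin n → DeBruijn L V p)
    (s : Fin p → Fin q), (t.subst σ).rename s = t.subst fun j => (σ j).rename s := by
  induction t with
  | free x => intro p q σ s; rfl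
  | bound i => intro p q σ s; rfl
  | app f ts ih =>
    intro p q σ s
    simp only [rename, subst, ih]
    congr 1
    funext i
    congr 1
    funext j
    induction j using Fin.addCases <;> simp [liftSubst, liftIndex, rename, rename_rename]

theorem liftSubst_subst {n p q : ℕ} (k : ℕ) (σ : Fin n → DeBruijn L V p)
    (τ : Fin p → DeBruijn L V q) :
    (fun j => (liftSubst k σ j).subst (liftSubst k τ)) = liftSubst k fun j => (σ j).subst τ := by
  funext j
  induction j using Fin.addCases <;> simp [liftSubst, subst, subst_rename, rename_subst]

theorem subst_subst {n : ℕ} (t : DeBruijn L V n) : ∀ {p q : ℕ} (σ : Fin n → DeBruijn L V p)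
    (τ : Fin p → DeBruijn L V q), (t.subst σ).subst τ = t.subst fun j => (σ j).subst τ := by
  induction t with
  | free x => intro p q σ τ; rfl
  | bound i => intro p q σ τ; rfl
  | app f ts ih =>
    intro p q σ τ
    simp only [subst, ih, liftSubst_subst]

theorem subst_bound {n : ℕ} (t : DeBruijn L V n) : t.subst bound = t := by
  induction t with
  | free x => rfl
  | bound i => rfl
  | app f ts ih =>
    simp only [subst]
    congr 1
    funext i
    conv_rhs => rw [← ih i]
    congr 1
    refine (liftSubst_bound _ id).trans (funext fun j => ?_)
    induction j using Fin.addCases <;> simp [liftIndex]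

variable (L V) in
/-- The model of de Bruijn terms, for a given interpretation of the predicate symbols. -/
abbrev model (I : (P : L.Pred) →
    ((i : Fin (L.predArity P).length) → DeBruijn L V ((L.predArity P).get i)) → Prop) :
    BindingModel.{u, max u w} L where
  carrier := DeBruijn L V
  proj := bound
  comp a b := a.subst b
  proj_comp _ _ := rfl
  comp_proj := subst_bound
  comp_assoc a b c := a.subst_subst b c
  func f _ ts := app f ts
  func_comp f p q a b := by
    change app f _ = app f _
    congr 1
    funext i
    congr 1
    funext j
    -- The model's `lift` shifts by a substitution of indices and `liftSubst` by a renaming;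
    -- `rename_eq_subst` identifies the two.
    induction j using Fin.addCases <;>
      simp [liftSubst, IntensionalStructure.lift, rename_eq_subst]
  pred := I

/-- The names that occur in a de Bruijn term. -/
def names : {n : ℕ} → DeBruijn L V n → Set V
  | _, free x => {x}
  | _, bound _ => ∅
  | _, app _ ts => ⋃ i, (ts i).names

theorem finite_names {n : ℕ} (t : DeBruijn L V n) : t.names.Finite := by
  induction t with
  | free x => exact Set.finite_singleton x
  | bound i => exact Set.finite_empty
  | app f ts ih => exact Set.finite_iUnion ih

/-- A de Bruijn term that is a name or an index. -/
def IsAtom {n : ℕ} (t : DeBruijn L V n) : Prop := (∃ x, t = free x) ∨ ∃ i, t = bound i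

end DeBruijn

/-! ### Fresh names, induction up to renaming, existence of substitutions. -/

section Freshness

variable {L : Language.{u}} {V : Type w}

theorem Term.finite_vars (t : Term L V) : t.vars.Finite := by
  induction t with
  | var x => exact Set.finite_singleton x
  | app f xs ts ih => exact Set.finite_iUnion fun i => (Set.finite_range _).union (ih i)

theorem Formula.finite_vars (A : Formula L V) : A.vars.Finite := by
  induction A with
  | atom P xs ts => exact Set.finite_iUnion fun i => (Set.finite_range _).union (ts i).finite_vars
  | imp A B ihA ihB => exact ihA.union ihB
  | and A B ihA ihB => exact ihA.union ihB
  | or A B ihA ihB => exact ihA.union ihB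
  | bot => exact Set.finite_empty
  | all x A ih => exact (Set.finite_singleton x).union ih
  | ex x A ih => exact (Set.finite_singleton x).union ih

theorem exists_injective_avoiding [Infinite V] {S : Set V} (hS : S.Finite) (α : Type)
    [Finite α] : ∃ f : α → V, Function.Injective f ∧ ∀ a, f a ∉ S := by
  have : Infinite (Sᶜ : Set V) := hS.infinite_compl.to_subtype
  obtain ⟨n, ⟨e⟩⟩ := Finite.exists_equiv_fin α
  refine ⟨fun a => (Infinite.natEmbedding (Sᶜ : Set V) (e a).val).1, fun a b h => ?_, fun a =>
    (Infinite.natEmbedding (Sᶜ : Set V) (e a).val).2⟩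
  exact e.injective (Fin.ext ((Infinite.natEmbedding _).injective (Subtype.ext h)))

theorem Binders.exists_avoiding [Infinite V] {S : Set V} (hS : S.Finite) (k : List ℕ) :
    ∃ ys : Binders k V, ∀ i j, ys.name i j ∉ S := by
  obtain ⟨f, hf, hfS⟩ := exists_injective_avoiding hS ((i : Fin k.length) × Fin (k.get i))
  exact ⟨⟨fun i j => f ⟨i, j⟩, hf⟩, fun i j => hfS _⟩

/-- The height of a term. -/
def Term.height : Term L V → ℕ
  | .var _ => 0
  | .app _ _ ts => (Finset.univ.sup fun i => (ts i).height) + 1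

theorem Term.height_lt (f : L.Func) (xs : Binders (L.funcArity f) V)
    (ts : Fin (L.funcArity f).length → Term L V) (i : Fin (L.funcArity f).length) :
    (ts i).height < (Term.app f xs ts).height :=
  Nat.lt_succ_of_le (Finset.le_sup (f := fun i => (ts i).height) (Finset.mem_univ i))

theorem Term.height_graft (t : Term L V) : ∀ {θ : V → Term L V},
    (∀ x, (θ x).height = 0) → (t.graft θ).height = t.height := by
  induction t with
  | var x => intro θ h; exact h x
  | app f xs ts ih =>
    intro θ h
    simp only [Term.graft, Term.height]
    congr 2
    funext i
    refine ih i fun x => ?_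
    rw [restrict]
    split_ifs
    · rfl
    · exact h x

theorem height_renameMap {k : ℕ} (ys : Fin k → V) (xs : Fin k → V) (x : V) :
    (renameMap ys xs x : Term L V).height = 0 := by
  classical
  rw [renameMap, Function.extend_def]
  split_ifs <;> rfl

/-- Induction on terms in which the scopes may be renamed. -/
theorem Term.rename_induction {P : Term L V → Prop} (var : ∀ x, P (.var x))
    (app : ∀ f xs ts, (∀ i (ys : Fin ((L.funcArity f).get i) → V),
      P ((ts i).graft (renameMap ys (xs.name i)))) → P (.app f xs ts)) (t : Term L V) : P t := by
  induction hn : t.height using Nat.strong_induction_on generalizing t with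
  | _ n ih =>
    cases t with
    | var x => exact var x
    | app f xs ts =>
      refine app f xs ts fun i ys => ih _ ?_ _ rfl
      -- A renamed scope is not a subterm, but replacing variables by variables keeps the height.
      rw [Term.height_graft _ (height_renameMap _ _), ← hn]
      exact Term.height_lt f xs ts i

theorem Term.exists_isSubst [Infinite V] (t : Term L V) (x : V) (u : Term L V) :
    ∃ u', Term.IsSubst t x u u' := by
  induction u using Term.rename_induction with
  | var z =>
    by_cases h : z = x
    · subst h; exact ⟨_, .var_self⟩
    · exact ⟨_, .var_other z h⟩
  | app f xs us ih =>
    obtain ⟨ys, hys⟩ := Binders.exists_avoiding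
      (((Term.app f xs us).finite_vars.union t.finite_vars).union (Set.finite_singleton x))
      (L.funcArity f)
    choose us' hus' using fun i => ih i (ys.name i)
    refine ⟨_, .app f xs ys us us' (fun i j => ?_) hus'⟩
    have := hys i j
    simp only [Set.mem_union, Set.mem_singleton_iff, not_or] at this
    exact ⟨this.1.1, this.1.2, this.2⟩

/-- The number of connectives of a proposition. -/
def Formula.size : Formula L V → ℕ
  | .atom _ _ _ => 0
  | .imp A B => A.size + B.size + 1
  | .and A B => A.size + B.size + 1
  | .or A B => A.size + B.size + 1
  | .bot => 0
  | .all _ A => A.size + 1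
  | .ex _ A => A.size + 1

/-- Terms do not count in `size`, so instances by arbitrary terms, and not only renamings, keep it.
The quantifier cases of `IsHenkin.sat` depend on this. -/
theorem Formula.size_graft (A : Formula L V) : ∀ θ : V → Term L V, (A.graft θ).size = A.size := by
  induction A <;> intro θ <;> simp [Formula.graft, Formula.size, *]

theorem Formula.IsSubst.size_eq {t : Term L V} {x : V} {A A' : Formula L V}
    (h : Formula.IsSubst t x A A') : A'.size = A.size := by
  induction h <;> simp_all [Formula.size, Formula.size_graft]

/-- Induction on propositions in which the scopes of the quantifiers may be replaced by
propositions of the same size. -/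
theorem Formula.size_induction {P : Formula L V → Prop} (atom : ∀ R xs ts, P (.atom R xs ts))
    (imp : ∀ A B, P A → P B → P (.imp A B)) (and : ∀ A B, P A → P B → P (.and A B))
    (or : ∀ A B, P A → P B → P (.or A B)) (bot : P .bot)
    (all : ∀ x A, (∀ A' : Formula L V, A'.size = A.size → P A') → P (.all x A))
    (ex : ∀ x A, (∀ A' : Formula L V, A'.size = A.size → P A') → P (.ex x A))
    (A : Formula L V) : P A := by
  induction hn : A.size using Nat.strong_induction_on generalizing A with
  | _ n ih =>
    subst hn
    cases A with
    | atom R xs ts => exact atom R xs ts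
    | imp A B =>
      exact imp A B (ih _ (by simp only [Formula.size]; omega) _ rfl)
        (ih _ (by simp only [Formula.size]; omega) _ rfl)
    | and A B =>
      exact and A B (ih _ (by simp only [Formula.size]; omega) _ rfl)
        (ih _ (by simp only [Formula.size]; omega) _ rfl)
    | or A B =>
      exact or A B (ih _ (by simp only [Formula.size]; omega) _ rfl)
        (ih _ (by simp only [Formula.size]; omega) _ rfl)
    | bot => exact bot
    | all x A => exact all x A fun A' h => ih _ (by simp only [Formula.size]; omega) _ rfl
    | ex x A => exact ex x A fun A' h => ih _ (by simp only [Formula.size]; omega) _ rfl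

theorem Formula.exists_isSubst [Infinite V] (t : Term L V) (x : V) (A : Formula L V) :
    ∃ A', Formula.IsSubst t x A A' := by
  have fresh : ∀ B : Formula L V, ∃ y, y ∉ B.vars ∧ y ∉ t.vars ∧ y ≠ x := by
    intro B
    obtain ⟨y, hy⟩ :=
      ((B.finite_vars.union t.finite_vars).union (Set.finite_singleton x)).exists_notMem
    simp only [Set.mem_union, Set.mem_singleton_iff, not_or] at hy
    exact ⟨y, hy.1.1, hy.1.2, hy.2⟩
  induction A using Formula.size_induction with
  | atom P xs us =>
    obtain ⟨ys, hys⟩ := Binders.exists_avoiding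
      (((Formula.atom P xs us).finite_vars.union t.finite_vars).union (Set.finite_singleton x))
      (L.predArity P)
    choose us' hus' using fun i =>
      Term.exists_isSubst t x ((us i).graft (renameMap (ys.name i) (xs.name i)))
    refine ⟨_, .atom P xs ys us us' (fun i j => ?_) hus'⟩
    have := hys i j
    simp only [Set.mem_union, Set.mem_singleton_iff, not_or] at this
    exact ⟨this.1.1, this.1.2, this.2⟩
  | imp A B ihA ihB => exact ⟨_, .imp ihA.choose_spec ihB.choose_spec⟩
  | and A B ihA ihB => exact ⟨_, .and ihA.choose_spec ihB.choose_spec⟩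
  | or A B ihA ihB => exact ⟨_, .or ihA.choose_spec ihB.choose_spec⟩
  | bot => exact ⟨_, .bot⟩
  | all z A ih =>
    obtain ⟨y, hy⟩ := fresh (.all z A)
    exact ⟨_, .all z y A _ hy (ih _ (A.size_graft _)).choose_spec⟩
  | ex z A ih =>
    obtain ⟨y, hy⟩ := fresh (.ex z A)
    exact ⟨_, .ex z y A _ hy (ih _ (A.size_graft _)).choose_spec⟩

end Freshness

/-! ### Comparison of named terms with de Bruijn terms. -/

section Adequacy

variable {L : Language.{u}} {V : Type w}
  (I : (P : L.Pred) →
    ((i : Fin (L.predArity P).length) → DeBruijn L V ((L.predArity P).get i)) → Prop)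

open DeBruijn

/-- Together with `injective_ext`, the invariant for reading a named term off its translation:
variables are never confused with applications, nor with one another. -/
theorem isAtom_ext {p k : ℕ} {ρ : V → DeBruijn L V p} (h : ∀ x, (ρ x).IsAtom) {ys : Fin k → V}
    (hy : Function.Injective ys) (x : V) : ((model L V I).ext ρ ys x : DeBruijn L V _).IsAtom := by
  by_cases hx : x ∈ Set.range ys
  · obtain ⟨j, rfl⟩ := hx
    rw [(model L V I).ext_name _ hy]
    exact Or.inr ⟨_, rfl⟩
  · rw [(model L V I).ext_of_notMem _ hx]
    rcases h x with ⟨z, hz⟩ | ⟨i, hi⟩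
    · rw [hz]; exact Or.inl ⟨z, rfl⟩
    · rw [hi]; exact Or.inr ⟨_, rfl⟩

/-- Binder names take the indices below `k`, in reversed order; old indices are shifted to `k` and
above, and free names stay free names. -/
theorem injective_ext {p k : ℕ} {ρ : V → DeBruijn L V p} (h : ∀ x, (ρ x).IsAtom)
    (hρ : Function.Injective ρ) {ys : Fin k → V} (hy : Function.Injective ys) :
    Function.Injective ((model L V I).ext ρ ys) := by
  have shift : ∀ {x}, x ∉ Set.range ys → (∃ z, ρ x = free z ∧ (model L V I).ext ρ ys x = free z) ∨
      ∃ i, ρ x = bound i ∧ (model L V I).ext ρ ys x = bound (Fin.natAdd k i) := by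
    intro x hx
    rw [(model L V I).ext_of_notMem _ hx]
    rcases h x with ⟨z, hz⟩ | ⟨i, hi⟩
    · exact Or.inl ⟨z, hz, by rw [hz]; rfl⟩
    · exact Or.inr ⟨i, hi, by rw [hi]; rfl⟩
  have name : ∀ j, (model L V I).ext ρ ys (ys j) = bound (Fin.castAdd p j.rev) :=
    fun j => (model L V I).ext_name _ hy j
  have ne : ∀ (j : Fin k) {x}, x ∉ Set.range ys →
      (model L V I).ext ρ ys (ys j) ≠ (model L V I).ext ρ ys x := by
    intro j x hx e
    rw [name] at e
    rcases shift hx with ⟨z, -, hz⟩ | ⟨i, -, hi⟩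
    · rw [hz] at e; cases e
    · rw [hi] at e
      have e := congrArg Fin.val (DeBruijn.bound.inj e)
      have := j.rev.isLt
      simp only [Fin.val_natAdd, Fin.val_castAdd] at e
      omega
  intro x y e
  by_cases hx : x ∈ Set.range ys
  · obtain ⟨j, rfl⟩ := hx
    by_cases hy' : y ∈ Set.range ys
    · obtain ⟨l, rfl⟩ := hy'
      rw [name, name] at e
      have e := DeBruijn.bound.inj e
      simp only [Fin.castAdd_inj, Fin.rev_inj] at e
      rw [e]
    · exact absurd e (ne j hy')
  · by_cases hy' : y ∈ Set.range ys
    · obtain ⟨l, rfl⟩ := hy'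
      exact absurd e.symm (ne l hx)
    · apply hρ
      rcases shift hx with ⟨z, h1, h2⟩ | ⟨i, h1, h2⟩ <;>
        rcases shift hy' with ⟨z', h3, h4⟩ | ⟨i', h3, h4⟩ <;> rw [h2, h4] at e
      · rw [h1, h3, DeBruijn.free.inj e]
      · cases e
      · cases e
      · have e := DeBruijn.bound.inj e
        simp only [Fin.natAdd_inj] at e
        rw [h1, h3, e]

/-- Terms with the same de Bruijn translation are `α`-equivalent. -/
theorem Term.alpha_of_eval_eq [Infinite V] (t : Term L V) : ∀ (t' : Term L V) {p : ℕ}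
    {ρ : V → DeBruijn L V p}, (∀ x, (ρ x).IsAtom) → Function.Injective ρ →
    (model L V I).eval t ρ = (model L V I).eval t' ρ → t.Alpha t' := by
  induction t using Term.rename_induction with
  | var x =>
    intro t' p ρ h hρ e
    cases t' with
    | var x' =>
      have : x = x' := hρ e
      subst this
      exact .var x
    | app f xs ts =>
      have e : ρ x = DeBruijn.app f _ := e
      rcases h x with ⟨z, hz⟩ | ⟨i, hi⟩
      · rw [hz] at e; cases e
      · rw [hi] at e; cases e
  | app f xs ts ih =>
    intro t' p ρ h hρ e
    cases t' with
    | var x =>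
      have e : DeBruijn.app f _ = ρ x := e
      rcases h x with ⟨z, hz⟩ | ⟨i, hi⟩
      · rw [hz] at e; cases e
      · rw [hi] at e; cases e
    | app f' xs' ts' =>
      have e : DeBruijn.app f (fun i => (model L V I).eval (ts i) ((model L V I).ext ρ (xs.name i))) =
        DeBruijn.app f' (fun i => (model L V I).eval (ts' i) ((model L V I).ext ρ (xs'.name i))) := e
      obtain ⟨rfl, e⟩ := DeBruijn.app.inj e
      have e := congrFun (eq_of_heq e)
      choose ys hy hyS using fun i => exists_injective_avoiding
        ((ts i).finite_vars.union (ts' i).finite_vars) (Fin ((L.funcArity f).get i))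
      have fresh : ∀ i j, ys i j ∉ (ts i).vars ∧ ys i j ∉ (ts' i).vars := fun i j => by
        simpa only [Set.mem_union, not_or] using hyS i j
      refine .app f xs xs' ts ts' ys hy fresh fun i => ?_
      refine ih i (ys i) _ (isAtom_ext I h (hy i)) (injective_ext I h hρ (hy i)) ?_
      rw [(model L V I).eval_graft_renameMap (ts i) ρ (hy i) (xs.injective i) fun j => (fresh i j).1,
        (model L V I).eval_graft_renameMap (ts' i) ρ (hy i) (xs'.injective i)
          fun j => (fresh i j).2]
      exact e i

theorem isAtom_free (x : V) : (free x : DeBruijn L V 0).IsAtom := Or.inl ⟨x, rfl⟩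

theorem injective_free : Function.Injective (free : V → DeBruijn L V 0) :=
  fun _ _ h => DeBruijn.free.inj h

/-- Atoms whose arguments have the same de Bruijn translations are `α`-equivalent. -/
theorem Formula.alpha_atom_of_eval_eq [Infinite V] {P : L.Pred} {xs xs' : Binders (L.predArity P) V}
    {ts ts' : Fin (L.predArity P).length → Term L V}
    (e : ∀ i, (model L V I).eval (ts i) ((model L V I).ext (p := 0) free (xs.name i)) =
      (model L V I).eval (ts' i) ((model L V I).ext (p := 0) free (xs'.name i))) :
    (Formula.atom P xs ts).Alpha (.atom P xs' ts') := by
  choose ys hy hyS using fun i => exists_injective_avoiding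
    ((ts i).finite_vars.union (ts' i).finite_vars) (Fin ((L.predArity P).get i))
  have fresh : ∀ i j, ys i j ∉ (ts i).vars ∧ ys i j ∉ (ts' i).vars := fun i j => by
    simpa only [Set.mem_union, not_or] using hyS i j
  refine .atom P xs xs' ts ts' ys hy fresh fun i => ?_
  refine Term.alpha_of_eval_eq I _ _ (isAtom_ext I isAtom_free (hy i))
    (injective_ext I isAtom_free injective_free (hy i)) ?_
  rw [(model L V I).eval_graft_renameMap (ts i) _ (hy i) (xs.injective i) fun j => (fresh i j).1,
    (model L V I).eval_graft_renameMap (ts' i) _ (hy i) (xs'.injective i) fun j => (fresh i j).2]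
  exact e i

/-- Not immediate, since the rules compare renamed scopes and never a scope with itself. Atoms are
handled through their translations, for which any interpretation of the predicates will do. -/
theorem Formula.Alpha.refl [Infinite V] (A : Formula L V) : A.Alpha A := by
  induction A using Formula.size_induction with
  | atom P xs ts => exact Formula.alpha_atom_of_eval_eq (fun _ _ => True) fun i => rfl
  | imp A B ihA ihB => exact .imp ihA ihB
  | and A B ihA ihB => exact .and ihA ihB
  | or A B ihA ihB => exact .or ihA ihB
  | bot => exact .bot
  | all x A ih =>
    obtain ⟨y, hy⟩ := A.finite_vars.exists_notMem
    exact .all x x y A A ⟨hy, hy⟩ (ih _ (A.size_graft _))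
  | ex x A ih =>
    obtain ⟨y, hy⟩ := A.finite_vars.exists_notMem
    exact .ex x x y A A ⟨hy, hy⟩ (ih _ (A.size_graft _))

/-- Every de Bruijn term is the value of a named term. -/
theorem DeBruijn.exists_eval_eq [Infinite V] {p : ℕ} (d : DeBruijn L V p) :
    ∀ {ρ : V → DeBruijn L V p}, (∀ i, ∃ x, ρ x = bound i) → (∀ z ∈ d.names, ∃ x, ρ x = free z) →
    ∃ t : Term L V, (model L V I).eval t ρ = d := by
  induction d with
  | free z =>
    intro ρ _ hf
    obtain ⟨x, hx⟩ := hf z rfl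
    exact ⟨.var x, hx⟩
  | bound i =>
    intro ρ hb _
    obtain ⟨x, hx⟩ := hb i
    exact ⟨.var x, hx⟩
  | @app n f ts ih =>
    intro ρ hb hf
    choose b hb using hb
    choose! g hg using hf
    -- The new binders must not hide the variables `b` that stand for the outer indices, nor the
    -- variables `g` that stand for the names in the term.
    obtain ⟨ys, hys⟩ := Binders.exists_avoiding
      ((Set.finite_range b).union ((DeBruijn.app f ts).finite_names.image g)) (L.funcArity f)
    have out : ∀ {i x}, x ∈ Set.range b ∪ g '' (DeBruijn.app f ts).names →
        x ∉ Set.range (ys.name i) := by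
      rintro i x hx ⟨j, rfl⟩
      exact hys i j hx
    have : ∀ i, ∃ t : Term L V,
        (model L V I).eval t ((model L V I).ext ρ (ys.name i)) = ts i := by
      refine fun i => ih i (fun l => ?_) fun z hz => ?_
      · induction l using Fin.addCases with
        | left l =>
          refine ⟨ys.name i l.rev, ?_⟩
          rw [(model L V I).ext_name _ (ys.injective i), Fin.rev_rev]
        | right l =>
          refine ⟨b l, ?_⟩
          rw [(model L V I).ext_of_notMem _ (out (Or.inl ⟨l, rfl⟩)), hb]
          rfl
      · have hz : z ∈ (DeBruijn.app f ts).names := Set.mem_iUnion.2 ⟨i, hz⟩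
        refine ⟨g z, ?_⟩
        rw [(model L V I).ext_of_notMem _ (out (Or.inr ⟨z, hz, rfl⟩)), hg z hz]
        rfl
    choose us hus using this
    refine ⟨.app f ys us, ?_⟩
    exact congrArg (DeBruijn.app f) (funext hus)

/-! ### Composition of renamings, and renaming of a quantified variable. -/

/-- The map `θ` sends the variables in `S` to variables, in such a way that following it by `θ'`
amounts to `θ''`; a variable that is moved leaves `S`. -/
def Factors (θ θ' θ'' : V → Term L V) (S : Set V) : Prop :=
  ∀ z ∈ S, ∃ y, θ z = .var y ∧ θ' y = θ'' z ∧ (y = z ∨ y ∉ S)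

theorem Factors.mono {θ θ' θ'' : V → Term L V} {S T : Set V} (h : Factors θ θ' θ'' T)
    (hS : S ⊆ T) : Factors θ θ' θ'' S := fun z hz => by
  obtain ⟨y, h1, h2, h3⟩ := h z (hS hz)
  exact ⟨y, h1, h2, h3.imp_right fun h hy => h (hS hy)⟩

/-- The clause that moved variables leave `S` serves here: such a variable is not among the binders
`R ⊆ S`, so the second map still acts on it. -/
theorem Factors.restrict {θ θ' θ'' : V → Term L V} {S R : Set V} (h : Factors θ θ' θ'' S)
    (hR : R ⊆ S) : Factors (restrict R θ) (restrict R θ') (restrict R θ'') S := fun z hz => by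
  by_cases hzR : z ∈ R
  · exact ⟨z, by simp [BindingLogic.restrict, hzR], by simp [BindingLogic.restrict, hzR],
      Or.inl rfl⟩
  · obtain ⟨y, h1, h2, h3⟩ := h z hz
    have hyR : y ∉ R := by
      rcases h3 with rfl | h3
      · exact hzR
      · exact fun hy => h3 (hR hy)
    exact ⟨y, by simp [BindingLogic.restrict, hzR, h1], by simp [BindingLogic.restrict, hzR, hyR, h2],
      h3⟩

theorem Term.graft_graft (t : Term L V) : ∀ {θ θ' θ'' : V → Term L V}, Factors θ θ' θ'' t.vars →
    (t.graft θ).graft θ' = t.graft θ'' := by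
  induction t with
  | var x =>
    intro θ θ' θ'' h
    obtain ⟨y, h1, h2, -⟩ := h x rfl
    simp only [Term.graft, h1, h2]
  | app f xs ts ih =>
    intro θ θ' θ'' h
    simp only [Term.graft]
    congr 1
    funext i
    exact ih i ((h.restrict fun x hx => Set.mem_iUnion.2 ⟨i, Or.inl hx⟩).mono
      fun x hx => Set.mem_iUnion.2 ⟨i, Or.inr hx⟩)

theorem Formula.graft_graft (A : Formula L V) : ∀ {θ θ' θ'' : V → Term L V},
    Factors θ θ' θ'' A.vars → (A.graft θ).graft θ' = A.graft θ'' := by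
  induction A with
  | atom P xs ts =>
    intro θ θ' θ'' h
    simp only [Formula.graft]
    congr 1
    funext i
    exact (ts i).graft_graft ((h.restrict fun x hx => Set.mem_iUnion.2 ⟨i, Or.inl hx⟩).mono
      fun x hx => Set.mem_iUnion.2 ⟨i, Or.inr hx⟩)
  | imp A B ihA ihB =>
    intro θ θ' θ'' h
    exact congrArg₂ Formula.imp (ihA (h.mono Set.subset_union_left)) (ihB (h.mono Set.subset_union_right))
  | and A B ihA ihB =>
    intro θ θ' θ'' h
    exact congrArg₂ Formula.and (ihA (h.mono Set.subset_union_left)) (ihB (h.mono Set.subset_union_right))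
  | or A B ihA ihB =>
    intro θ θ' θ'' h
    exact congrArg₂ Formula.or (ihA (h.mono Set.subset_union_left)) (ihB (h.mono Set.subset_union_right))
  | bot => intro θ θ' θ'' _; rfl
  | all x A ih =>
    intro θ θ' θ'' h
    exact congrArg (Formula.all x) (ih ((h.restrict Set.subset_union_left).mono Set.subset_union_right))
  | ex x A ih =>
    intro θ θ' θ'' h
    exact congrArg (Formula.ex x) (ih ((h.restrict Set.subset_union_left).mono Set.subset_union_right))

theorem Formula.graft_renameMap_renameMap (A : Formula L V) {c : V} (x y : V) (hc : c ∉ A.vars) :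
    (A.graft (renameMap ![c] ![x])).graft (renameMap ![y] ![c]) =
      A.graft (renameMap ![y] ![x]) := by
  refine A.graft_graft fun z hz => ?_
  by_cases hzx : z = x
  · subst hzx
    exact ⟨c, by simp [renameMap_vec_self], by simp [renameMap_vec_self], Or.inr hc⟩
  · have hzc : z ≠ c := fun e => hc (e ▸ hz)
    exact ⟨z, by simp [renameMap_vec_of_ne, hzx], by simp [renameMap_vec_of_ne, hzx, hzc],
      Or.inl rfl⟩

/-- With `c` as eigenvariable, the quantifier rule produces the left-hand proposition; this brings
it back to the original one. The intermediate name `c` disappears by `graft_renameMap_renameMap`. -/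
theorem Formula.alpha_all [Infinite V] (A : Formula L V) {c : V} (x : V) (hc : c ∉ A.vars) :
    (Formula.all c (A.graft (renameMap ![c] ![x]))).Alpha (.all x A) := by
  obtain ⟨y, hy⟩ := ((A.graft (renameMap ![c] ![x])).finite_vars.union A.finite_vars).exists_notMem
  refine .all c x y _ A (by simpa only [Set.mem_union, not_or] using hy) ?_
  rw [A.graft_renameMap_renameMap x y hc]
  exact .refl _

theorem Formula.alpha_ex [Infinite V] (A : Formula L V) {c : V} (x : V) (hc : c ∉ A.vars) :
    (Formula.ex c (A.graft (renameMap ![c] ![x]))).Alpha (.ex x A) := by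
  obtain ⟨y, hy⟩ := ((A.graft (renameMap ![c] ![x])).finite_vars.union A.finite_vars).exists_notMem
  refine .ex c x y _ A (by simpa only [Set.mem_union, not_or] using hy) ?_
  rw [A.graft_renameMap_renameMap x y hc]
  exact .refl _

end Adequacy

/-! ### Countability of the syntax. -/

section Countability

variable {L : Language.{u}} {V : Type w}

instance Binders.countable [Countable V] (k : List ℕ) : Countable (Binders k V) :=
  Function.Injective.countable (f := Binders.name) fun a b h => by
    cases a; cases b; cases h; rfl

instance Term.countable [Countable L.Func] [Countable V] : Countable (Term L V) := by
  have key : ∀ n, Set.Countable {t : Term L V | t.height < n} := by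
    intro n
    induction n with
    | zero => simp
    | succ n ih =>
      have : Countable {t : Term L V // t.height < n} := ih.to_subtype
      refine ((Set.countable_range (Term.var : V → Term L V)).union (Set.countable_range
        fun a : (f : L.Func) × Binders (L.funcArity f) V ×
          (Fin (L.funcArity f).length → {t : Term L V // t.height < n}) =>
            Term.app a.1 a.2.1 fun i => (a.2.2 i).1)).mono ?_
      intro t ht
      cases t with
      | var x => exact Or.inl ⟨x, rfl⟩
      | app f xs ts =>
        refine Or.inr ⟨⟨f, xs, fun i => ⟨ts i, ?_⟩⟩, rfl⟩
        have := Term.height_lt f xs ts i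
        have ht : (Term.app f xs ts).height < n + 1 := ht
        omega
  refine Set.countable_univ_iff.1 ((Set.countable_iUnion key).mono fun t _ => ?_)
  exact Set.mem_iUnion.2 ⟨t.height + 1, Nat.lt_succ_self _⟩

instance Formula.countable [Countable L.Func] [Countable L.Pred] [Countable V] :
    Countable (Formula L V) := by
  have key : ∀ n, Set.Countable {A : Formula L V | A.size < n} := by
    intro n
    induction n with
    | zero => simp
    | succ n ih =>
      refine ((((((Set.countable_range
        fun a : (P : L.Pred) × Binders (L.predArity P) V ×
          (Fin (L.predArity P).length → Term L V) => Formula.atom a.1 a.2.1 a.2.2).union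
        (ih.image2 ih .imp)).union (ih.image2 ih .and)).union (ih.image2 ih .or)).union
        (Set.countable_singleton .bot)).union
        ((Set.countable_univ (α := V)).image2 ih .all)).union
        ((Set.countable_univ (α := V)).image2 ih .ex) |>.mono ?_
      intro A hA
      simp only [Set.mem_union]
      have hA : A.size < n + 1 := hA
      cases A with
      | atom P xs ts => exact .inl (.inl (.inl (.inl (.inl (.inl ⟨⟨P, xs, ts⟩, rfl⟩)))))
      | imp A B =>
        simp only [Formula.size] at hA
        exact .inl (.inl (.inl (.inl (.inl (.inr ⟨A, show A.size < n by omega, B,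
          show B.size < n by omega, rfl⟩)))))
      | and A B =>
        simp only [Formula.size] at hA
        exact .inl (.inl (.inl (.inl (.inr ⟨A, show A.size < n by omega, B,
          show B.size < n by omega, rfl⟩))))
      | or A B =>
        simp only [Formula.size] at hA
        exact .inl (.inl (.inl (.inr ⟨A, show A.size < n by omega, B,
          show B.size < n by omega, rfl⟩)))
      | bot => exact .inl (.inl (.inr rfl))
      | all x A =>
        simp only [Formula.size] at hA
        exact .inl (.inr ⟨x, trivial, A, show A.size < n by omega, rfl⟩)
      | ex x A =>
        simp only [Formula.size] at hA
        exact .inr ⟨x, trivial, A, show A.size < n by omega, rfl⟩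
  refine Set.countable_univ_iff.1 ((Set.countable_iUnion key).mono fun A _ => ?_)
  exact Set.mem_iUnion.2 ⟨A.size + 1, Nat.lt_succ_self _⟩

end Countability

/-! ### Structural rules and the Henkin extension. -/

section Henkin

variable {L : Language.{u}} {V : Type w}

theorem Provable.add_left {Γ Δ : Multiset (Formula L V)} (h : Provable Γ Δ)
    (Γ' : Multiset (Formula L V)) : Provable (Γ' + Γ) Δ := by
  induction Γ' using Multiset.induction_on with
  | empty => simpa using h
  | cons A Γ' ih => rw [Multiset.cons_add]; exact .weakLeft ih

theorem Provable.add_right {Γ Δ : Multiset (Formula L V)} (h : Provable Γ Δ)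
    (Δ' : Multiset (Formula L V)) : Provable Γ (Δ' + Δ) := by
  induction Δ' using Multiset.induction_on with
  | empty => simpa using h
  | cons A Δ' ih => rw [Multiset.cons_add]; exact .weakRight ih

theorem Provable.contract_left {Γ Γ' Δ : Multiset (Formula L V)} (h : Provable (Γ' + Γ) Δ)
    (hΓ : Γ' ⊆ Γ) : Provable Γ Δ := by
  induction Γ' using Multiset.induction_on with
  | empty => simpa using h
  | cons A Γ' ih =>
    rw [Multiset.cons_subset] at hΓ
    refine ih ?_ hΓ.2
    obtain ⟨Θ, hΘ⟩ := Multiset.exists_cons_of_mem (Multiset.mem_add.2 (Or.inr hΓ.1) : A ∈ Γ' + Γ)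
    rw [Multiset.cons_add, hΘ] at h
    rw [hΘ]
    exact .contrLeft h

theorem Provable.contract_right {Γ Δ Δ' : Multiset (Formula L V)} (h : Provable Γ (Δ' + Δ))
    (hΔ : Δ' ⊆ Δ) : Provable Γ Δ := by
  induction Δ' using Multiset.induction_on with
  | empty => simpa using h
  | cons A Δ' ih =>
    rw [Multiset.cons_subset] at hΔ
    refine ih ?_ hΔ.2
    obtain ⟨Θ, hΘ⟩ := Multiset.exists_cons_of_mem (Multiset.mem_add.2 (Or.inr hΔ.1) : A ∈ Δ' + Δ)
    rw [Multiset.cons_add, hΘ] at h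
    rw [hΘ]
    exact .contrRight h

/-- Inclusion `⊆` of multisets ignores multiplicities: weaken by all of `Γ'` and `Δ'`, then contract
the members of `Γ` and `Δ` away. -/
theorem Provable.mono {Γ Γ' Δ Δ' : Multiset (Formula L V)} (h : Provable Γ Δ) (hΓ : Γ ⊆ Γ')
    (hΔ : Δ ⊆ Δ') : Provable Γ' Δ' := by
  have h := (h.add_left Γ').add_right Δ'
  rw [add_comm Γ', add_comm Δ'] at h
  exact (h.contract_left hΓ).contract_right hΔ

theorem finite_vars_multiset (Γ : Multiset (Formula L V)) :
    {x | ∃ A ∈ Γ, x ∈ A.vars}.Finite := by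
  refine (Set.Finite.biUnion (Multiset.finite_toSet Γ) fun A _ => A.finite_vars).subset ?_
  rintro x ⟨A, hA, hx⟩
  exact Set.mem_biUnion hA hx

theorem rel_alpha_refl [Infinite V] (Γ : Multiset (Formula L V)) :
    Multiset.Rel Formula.Alpha Γ Γ :=
  Multiset.rel_refl_of_refl_on fun A _ => Formula.Alpha.refl A

/-- A fresh witness may be added for an existential proposition on the left. -/
theorem Provable.of_witness_left [Infinite V] {Γ Δ : Multiset (Formula L V)} {x c : V}
    {A : Formula L V} (hA : c ∉ A.vars) (hΓ : ∀ B ∈ .ex x A ::ₘ Γ, c ∉ B.vars)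
    (hΔ : ∀ B ∈ Δ, c ∉ B.vars)
    (h : Provable (A.graft (renameMap ![c] ![x]) ::ₘ .ex x A ::ₘ Γ) Δ) :
    Provable (.ex x A ::ₘ Γ) Δ := by
  have h := Provable.exLeft (fun B hB hc => hΓ B hB (B.freeVars_subset_vars hc))
    (fun B hB hc => hΔ B hB (B.freeVars_subset_vars hc)) h
  -- The rule has turned the witness into a proposition quantified over `c`, which is `α`-equivalent
  -- to the one already there and is contracted with it.
  exact .contrLeft (.alpha (.cons (A.alpha_ex x hA) (rel_alpha_refl _)) (rel_alpha_refl _) h)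

/-- A fresh witness may be added for a universal proposition on the right. -/
theorem Provable.of_witness_right [Infinite V] {Γ Δ : Multiset (Formula L V)} {x c : V}
    {A : Formula L V} (hA : c ∉ A.vars) (hΓ : ∀ B ∈ Γ, c ∉ B.vars)
    (hΔ : ∀ B ∈ .all x A ::ₘ Δ, c ∉ B.vars)
    (h : Provable Γ (A.graft (renameMap ![c] ![x]) ::ₘ .all x A ::ₘ Δ)) :
    Provable Γ (.all x A ::ₘ Δ) := by
  have h := Provable.allRight (fun B hB hc => hΓ B hB (B.freeVars_subset_vars hc))
    (fun B hB hc => hΔ B hB (B.freeVars_subset_vars hc)) h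
  exact .contrRight (.alpha (rel_alpha_refl _) (.cons (A.alpha_all x hA) (rel_alpha_refl _)) h)

/-- The proposition `A` belongs to `T`, with a witness if it is existential. -/
def WitnessedEx (T : Set (Formula L V)) (A : Formula L V) : Prop :=
  A ∈ T ∧ ∀ x B, A = .ex x B → ∃ c, c ∉ B.vars ∧ B.graft (renameMap ![c] ![x]) ∈ T

/-- The proposition `A` belongs to `F`, with a counterexample if it is universal. -/
def WitnessedAll (F : Set (Formula L V)) (A : Formula L V) : Prop :=
  A ∈ F ∧ ∀ x B, A = .all x B → ∃ c, c ∉ B.vars ∧ B.graft (renameMap ![c] ![x]) ∈ F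

theorem WitnessedEx.mono {T T' : Set (Formula L V)} {A : Formula L V} (h : WitnessedEx T A)
    (hT : T ⊆ T') : WitnessedEx T' A :=
  ⟨hT h.1, fun x B e => (h.2 x B e).imp fun _ hc => ⟨hc.1, hT hc.2⟩⟩

theorem WitnessedAll.mono {F F' : Set (Formula L V)} {A : Formula L V} (h : WitnessedAll F A)
    (hF : F ⊆ F') : WitnessedAll F' A :=
  ⟨hF h.1, fun x B e => (h.2 x B e).imp fun _ hc => ⟨hc.1, hF hc.2⟩⟩

/-- An unprovable sequent has an unprovable extension that decides a given proposition. -/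
theorem exists_extension_deciding [Infinite V] {Γ Δ : Multiset (Formula L V)}
    (h : ¬ Provable Γ Δ) (A : Formula L V) :
    ∃ Γ' Δ', ¬ Provable Γ' Δ' ∧ Γ ⊆ Γ' ∧ Δ ⊆ Δ' ∧
      (WitnessedEx {B | B ∈ Γ'} A ∨ WitnessedAll {B | B ∈ Δ'} A) := by
  by_cases hA : Provable (A ::ₘ Γ) Δ
  · have hA' : ¬ Provable Γ (A ::ₘ Δ) := fun h' => h (.cut A hA h')
    by_cases hq : ∃ x B, A = .all x B
    · obtain ⟨x, B, rfl⟩ := hq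
      obtain ⟨c, hc⟩ := ((finite_vars_multiset Γ).union
        (finite_vars_multiset (.all x B ::ₘ Δ))).exists_notMem
      simp only [Set.mem_union, Set.mem_ofPred_eq, not_or, not_exists, not_and] at hc
      have hcB : c ∉ B.vars := fun h => hc.2 _ (Multiset.mem_cons_self _ _) (Or.inr h)
      refine ⟨Γ, B.graft (renameMap ![c] ![x]) ::ₘ .all x B ::ₘ Δ,
        fun h => hA' (.of_witness_right hcB hc.1 hc.2 h), fun _ h => h,
        fun _ h => by simp [h], Or.inr ⟨by simp, ?_⟩⟩
      intro x' B' e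
      cases e
      exact ⟨c, hcB, by simp⟩
    · exact ⟨Γ, A ::ₘ Δ, hA', fun _ h => h, fun _ h => by simp [h],
        Or.inr ⟨by simp, fun x B e => absurd ⟨x, B, e⟩ hq⟩⟩
  · by_cases hq : ∃ x B, A = .ex x B
    · obtain ⟨x, B, rfl⟩ := hq
      obtain ⟨c, hc⟩ := ((finite_vars_multiset (.ex x B ::ₘ Γ)).union
        (finite_vars_multiset Δ)).exists_notMem
      simp only [Set.mem_union, Set.mem_ofPred_eq, not_or, not_exists, not_and] at hc
      have hcB : c ∉ B.vars := fun h => hc.1 _ (Multiset.mem_cons_self _ _) (Or.inr h)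
      refine ⟨B.graft (renameMap ![c] ![x]) ::ₘ .ex x B ::ₘ Γ, Δ,
        fun h => hA (.of_witness_left hcB hc.1 hc.2 h), fun _ h => by simp [h],
        fun _ h => h, Or.inl ⟨by simp, ?_⟩⟩
      intro x' B' e
      cases e
      exact ⟨c, hcB, by simp⟩
    · exact ⟨A ::ₘ Γ, Δ, hA, fun _ h => by simp [h], fun _ h => h,
        Or.inl ⟨by simp, fun x B e => absurd ⟨x, B, e⟩ hq⟩⟩

/-- A pair of sets of propositions that is unprovable, decides every proposition and has
witnesses. -/
structure IsHenkin (T F : Set (Formula L V)) : Prop where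
  not_provable : ∀ Γ Δ : Multiset (Formula L V), (∀ A ∈ Γ, A ∈ T) → (∀ A ∈ Δ, A ∈ F) →
    ¬ Provable Γ Δ
  decides : ∀ A, WitnessedEx T A ∨ WitnessedAll F A

/-- The propositions are decided one by one. Every stage is a finite sequent, so fresh witnesses
never run out, and a derivation uses finitely many propositions, so the union of the stages is as
unprovable as each of them. -/
theorem exists_isHenkin [Infinite V] [Countable (Formula L V)] {Γ Δ : Multiset (Formula L V)}
    (h : ¬ Provable Γ Δ) :
    ∃ T F : Set (Formula L V), IsHenkin T F ∧ (∀ A ∈ Γ, A ∈ T) ∧ ∀ A ∈ Δ, A ∈ F := by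
  have : Nonempty (Formula L V) := ⟨.bot⟩
  obtain ⟨e, he⟩ := exists_surjective_nat (Formula L V)
  let S := {s : Multiset (Formula L V) × Multiset (Formula L V) // ¬ Provable s.1 s.2}
  have step : ∀ (s : S) (A : Formula L V), ∃ s' : S, s.1.1 ⊆ s'.1.1 ∧ s.1.2 ⊆ s'.1.2 ∧
      (WitnessedEx {B | B ∈ s'.1.1} A ∨ WitnessedAll {B | B ∈ s'.1.2} A) := by
    intro s A
    obtain ⟨Γ', Δ', h', h1, h2, h3⟩ := exists_extension_deciding s.2 A
    exact ⟨⟨(Γ', Δ'), h'⟩, h1, h2, h3⟩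
  choose next hl hr hd using step
  let seq : ℕ → S := fun n => Nat.rec ⟨(Γ, Δ), h⟩ (fun n s => next s (e n)) n
  have monoL : ∀ {m n}, m ≤ n → (seq m).1.1 ⊆ (seq n).1.1 := by
    intro m n hmn
    induction hmn with
    | refl => exact fun _ h => h
    | step _ ih => exact fun _ h => hl _ _ (ih h)
  have monoR : ∀ {m n}, m ≤ n → (seq m).1.2 ⊆ (seq n).1.2 := by
    intro m n hmn
    induction hmn with
    | refl => exact fun _ h => h
    | step _ ih => exact fun _ h => hr _ _ (ih h)
  -- A multiset drawn from the union lies in a single stage, up to multiplicities, which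
  -- `Provable.mono` disregards.
  have bound : ∀ {f : ℕ → Multiset (Formula L V)}, (∀ {m n}, m ≤ n → f m ⊆ f n) →
      ∀ Θ : Multiset (Formula L V), (∀ A ∈ Θ, ∃ n, A ∈ f n) → ∃ n, Θ ⊆ f n := by
    intro f hf Θ
    induction Θ using Multiset.induction_on with
    | empty => exact fun _ => ⟨0, Multiset.zero_subset _⟩
    | cons A Θ ih =>
      intro hΘ
      obtain ⟨m, hm⟩ := hΘ A (Multiset.mem_cons_self _ _)
      obtain ⟨n, hn⟩ := ih fun B hB => hΘ B (Multiset.mem_cons_of_mem hB)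
      exact ⟨max m n, Multiset.cons_subset.2 ⟨hf (le_max_left _ _) hm,
        fun _ h => hf (le_max_right _ _) (hn h)⟩⟩
  refine ⟨{A | ∃ n, A ∈ (seq n).1.1}, {A | ∃ n, A ∈ (seq n).1.2}, ⟨?_, ?_⟩,
    fun A hA => ⟨0, hA⟩, fun A hA => ⟨0, hA⟩⟩
  · intro Γ' Δ' hΓ hΔ hp
    obtain ⟨m, hm⟩ := bound monoL Γ' hΓ
    obtain ⟨n, hn⟩ := bound monoR Δ' hΔ
    exact (seq (max m n)).2 (hp.mono (fun _ h => monoL (le_max_left _ _) (hm h))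
      fun _ h => monoR (le_max_right _ _) (hn h))
  · intro A
    obtain ⟨n, rfl⟩ := he A
    exact (hd (seq n) (e n)).imp (fun h => h.mono fun B hB => ⟨n + 1, hB⟩)
      fun h => h.mono fun B hB => ⟨n + 1, hB⟩

/-! ### The term model of a Henkin pair. -/

open DeBruijn

/-- Needed because `termInterpretation` has to evaluate terms before the predicates of its model are
fixed, and so uses a dummy interpretation. -/
theorem eval_model_eq (I I' : (P : L.Pred) →
    ((i : Fin (L.predArity P).length) → DeBruijn L V ((L.predArity P).get i)) → Prop)
    (t : Term L V) : ∀ {p : ℕ} (ρ : V → DeBruijn L V p),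
    (model L V I).eval t ρ = (model L V I').eval t ρ := by
  induction t with
  | var x => intro p ρ; rfl
  | app f xs ts ih => intro p ρ; exact congrArg (DeBruijn.app f) (funext fun i => ih i _)

/-- The interpretation of the predicate symbols by a set of propositions. -/
def termInterpretation (T : Set (Formula L V)) (P : L.Pred)
    (d : (i : Fin (L.predArity P).length) → DeBruijn L V ((L.predArity P).get i)) : Prop :=
  ∃ xs ts, Formula.atom P xs ts ∈ T ∧
    ∀ i, (model L V fun _ _ => True).eval (ts i)
      ((model L V fun _ _ => True).ext (p := 0) free (xs.name i)) = d i

variable {T F : Set (Formula L V)}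

theorem IsHenkin.mem_or_mem (h : IsHenkin T F) (A : Formula L V) : A ∈ T ∨ A ∈ F :=
  (h.decides A).imp And.left And.left

theorem IsHenkin.mem_left_of_provable (h : IsHenkin T F) {Γ : Multiset (Formula L V)}
    {A : Formula L V} (hp : Provable Γ {A}) (hΓ : ∀ B ∈ Γ, B ∈ T) : A ∈ T :=
  (h.mem_or_mem A).resolve_right fun hA =>
    h.not_provable Γ {A} hΓ (fun _ hB => Multiset.mem_singleton.1 hB ▸ hA) hp

theorem IsHenkin.mem_right_of_provable (h : IsHenkin T F) {Δ : Multiset (Formula L V)}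
    {A : Formula L V} (hp : Provable {A} Δ) (hΔ : ∀ B ∈ Δ, B ∈ F) : A ∈ F :=
  (h.mem_or_mem A).resolve_left fun hA =>
    h.not_provable {A} Δ (fun _ hB => Multiset.mem_singleton.1 hB ▸ hA) hΔ hp

theorem IsHenkin.notMem_right (h : IsHenkin T F) {A : Formula L V} (hT : A ∈ T) : A ∉ F :=
  fun hF => h.not_provable {A} {A} (fun _ hB => Multiset.mem_singleton.1 hB ▸ hT)
    (fun _ hB => Multiset.mem_singleton.1 hB ▸ hF) (.ax A)

theorem IsHenkin.exists_witness (h : IsHenkin T F) {x : V} {A : Formula L V}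
    (hA : .ex x A ∈ T) : ∃ c, c ∉ A.vars ∧ A.graft (renameMap ![c] ![x]) ∈ T :=
  ((h.decides (.ex x A)).resolve_right fun h' => h.notMem_right hA h'.1).2 x A rfl

theorem IsHenkin.exists_counterexample (h : IsHenkin T F) {x : V} {A : Formula L V}
    (hA : .all x A ∈ F) : ∃ c, c ∉ A.vars ∧ A.graft (renameMap ![c] ![x]) ∈ F :=
  ((h.decides (.all x A)).resolve_left fun h' => h.notMem_right h'.1 hA).2 x A rfl

theorem Provable.of_mem {A : Formula L V} {Γ Δ : Multiset (Formula L V)} (hΓ : A ∈ Γ)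
    (hΔ : A ∈ Δ) : Provable Γ Δ :=
  (Provable.ax A).mono (by simpa using hΓ) (by simpa using hΔ)

/-- A Henkin pair is satisfied by its term model. -/
theorem IsHenkin.sat [Infinite V] (h : IsHenkin T F) (A : Formula L V) :
    (A ∈ T → (model L V (termInterpretation T)).Sat free A) ∧
      (A ∈ F → ¬ (model L V (termInterpretation T)).Sat free A) := by
  classical
  -- Every element of the domain is the value of a term, so truth of `A` at `a` is truth of an
  -- instance of `A`.
  have subst : ∀ (x : V) (A : Formula L V) (a : DeBruijn L V 0),
      ∃ t A', Formula.IsSubst t x A A' ∧ ((model L V (termInterpretation T)).Sat free A' ↔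
        (model L V (termInterpretation T)).Sat (Function.update free x a) A) := by
    intro x A a
    obtain ⟨t, rfl⟩ := DeBruijn.exists_eval_eq (termInterpretation T) a (ρ := free)
      (fun i => i.elim0) fun z _ => ⟨z, rfl⟩
    obtain ⟨A', hA'⟩ := Formula.exists_isSubst t x A
    exact ⟨t, A', hA', (model L V (termInterpretation T)).sat_isSubst hA' free⟩
  induction A using Formula.size_induction with
  | atom P xs ts =>
    rw [(model L V (termInterpretation T)).sat_atom]
    constructor
    · exact fun hA => ⟨xs, ts, hA, fun i => eval_model_eq _ _ _ _⟩
    -- If the atom were true, `T` would contain an atom with the same translation, hence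
    -- `α`-equivalent to the given one, which is in `F`.
    · rintro hA ⟨xs', ts', hA', e⟩
      have hα : (Formula.atom P xs' ts').Alpha (.atom P xs ts) :=
        Formula.alpha_atom_of_eval_eq (fun _ _ => True) fun i =>
          (e i).trans (eval_model_eq _ _ _ _)
      refine h.not_provable {.atom P xs' ts'} {.atom P xs ts} (by simpa using hA')
        (by simpa using hA) ?_
      exact .alpha (rel_alpha_refl _) (.cons hα .zero) (.ax (.atom P xs' ts'))
  | imp A B ihA ihB =>
    constructor
    · intro hAB hA
      refine ihB.1 (h.mem_left_of_provable (Γ := {.imp A B, A}) ?_ ?_)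
      · exact .impLeft (.of_mem (A := A) (by simp) (by simp)) (.of_mem (A := B) (by simp) (by simp))
      · have := (h.mem_or_mem A).resolve_right fun hF => ihA.2 hF hA
        simp [hAB, this]
    · intro hAB hs
      have hA : A ∈ T := (h.mem_or_mem A).resolve_right fun hF => h.not_provable 0 {.imp A B, A}
        (by simp) (by simp [hAB, hF]) (.impRight (.of_mem (A := A) (by simp) (by simp)))
      have hB : B ∈ F := h.mem_right_of_provable (Δ := {.imp A B})
        (.impRight (.of_mem (A := B) (by simp) (by simp))) (by simpa using hAB)
      exact ihB.2 hB (hs (ihA.1 hA))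
  | and A B ihA ihB =>
    constructor
    · intro hAB
      refine ⟨ihA.1 (h.mem_left_of_provable (Γ := {.and A B}) ?_ (by simpa using hAB)),
        ihB.1 (h.mem_left_of_provable (Γ := {.and A B}) ?_ (by simpa using hAB))⟩
      · exact .andLeft (.of_mem (A := A) (by simp) (by simp))
      · exact .andLeft (.of_mem (A := B) (by simp) (by simp))
    · rintro hAB ⟨hA, hB⟩
      have hA : A ∈ T := (h.mem_or_mem A).resolve_right fun hF => ihA.2 hF hA
      have hB : B ∈ T := (h.mem_or_mem B).resolve_right fun hF => ihB.2 hF hB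
      refine h.not_provable {A, B} {.and A B} (by simp [hA, hB]) (by simpa using hAB) ?_
      exact .andRight (.of_mem (A := A) (by simp) (by simp)) (.of_mem (A := B) (by simp) (by simp))
  | or A B ihA ihB =>
    constructor
    · intro hAB
      by_contra hc
      have hA : A ∈ F := (h.mem_or_mem A).resolve_left fun hT => hc (Or.inl (ihA.1 hT))
      have hB : B ∈ F := (h.mem_or_mem B).resolve_left fun hT => hc (Or.inr (ihB.1 hT))
      refine h.not_provable {.or A B} {A, B} (by simpa using hAB) (by simp [hA, hB]) ?_
      exact .orLeft (.of_mem (A := A) (by simp) (by simp)) (.of_mem (A := B) (by simp) (by simp))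
    · rintro hAB (hs | hs)
      · refine ihA.2 (h.mem_right_of_provable (Δ := {.or A B}) ?_ (by simpa using hAB)) hs
        exact .orRight (.of_mem (A := A) (by simp) (by simp))
      · refine ihB.2 (h.mem_right_of_provable (Δ := {.or A B}) ?_ (by simpa using hAB)) hs
        exact .orRight (.of_mem (A := B) (by simp) (by simp))
  | bot =>
    exact ⟨fun hT => (h.not_provable {.bot} 0 (by simpa using hT) (by simp) .botLeft).elim,
      fun _ hs => hs⟩
  | all x A ih =>
    constructor
    · intro hA a
      obtain ⟨t, A', hA', hs⟩ := subst x A a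
      refine hs.1 ((ih A' hA'.size_eq).1 (h.mem_left_of_provable (Γ := {.all x A}) ?_
        (by simpa using hA)))
      exact .allLeft t hA' (.ax A')
    · intro hA hs
      -- The counterexample is a variable `c`, whose value is the element `free c`.
      obtain ⟨c, hc, hcF⟩ := h.exists_counterexample hA
      refine (ih _ (A.size_graft _)).2 hcF ?_
      rw [(model L V (termInterpretation T)).sat_graft_renameMap A _ hc]
      exact hs _
  | ex x A ih =>
    constructor
    · intro hA
      obtain ⟨c, hc, hcT⟩ := h.exists_witness hA
      have hs := (ih _ (A.size_graft _)).1 hcT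
      rw [(model L V (termInterpretation T)).sat_graft_renameMap A _ hc] at hs
      exact ⟨_, hs⟩
    · rintro hA ⟨a, ha⟩
      obtain ⟨t, A', hA', hs⟩ := subst x A a
      refine (ih A' hA'.size_eq).2 (h.mem_right_of_provable (Δ := {.ex x A}) ?_
        (by simpa using hA)) (hs.2 ha)
      exact .exRight t hA' (.ax A')

end Henkin

/-! ### Embedding a sublanguage: syntax and derivations. -/

section Sublanguage

/-- The sublanguage with the function symbols in `F` and the predicate symbols in `Q`. -/
abbrev Language.sub (L : Language.{u}) (F : Set L.Func) (Q : Set L.Pred) : Language.{u} where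
  Func := F
  Pred := Q
  funcArity f := L.funcArity f
  predArity P := L.predArity P

variable {L : Language.{u}} {F : Set L.Func} {Q : Set L.Pred} {V : Type w} {W : Type w'}
  {ι : W → V} (hι : Function.Injective ι)

/-- Binders with their names mapped by an injection. -/
def Binders.map {k : List ℕ} (xs : Binders k W) : Binders k V where
  name i j := ι (xs.name i j)
  distinct := hι.comp xs.distinct

/-- The embedding of the terms of a sublanguage, along an injection of the variables. -/
def Term.map : Term (L.sub F Q) W → Term L V
  | .var x => .var (ι x)
  | .app f xs ts => .app f.1 (xs.map hι) fun i => (ts i).map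

/-- The embedding of the propositions of a sublanguage, along an injection of the variables. -/
def Formula.map : Formula (L.sub F Q) W → Formula L V
  | .atom P xs ts => .atom P.1 (xs.map hι) fun i => (ts i).map hι
  | .imp A B => .imp A.map B.map
  | .and A B => .and A.map B.map
  | .or A B => .or A.map B.map
  | .bot => .bot
  | .all x A => .all (ι x) A.map
  | .ex x A => .ex (ι x) A.map

theorem Binders.range_map {k : List ℕ} (xs : Binders k W) (i : Fin k.length) :
    Set.range ((xs.map hι).name i) = ι '' Set.range (xs.name i) :=
  Set.range_comp ι (xs.name i)

theorem Term.vars_map (t : Term (L.sub F Q) W) : (t.map hι).vars = ι '' t.vars := by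
  induction t with
  | var x => simp [Term.map, Term.vars]
  | app f xs ts ih =>
    simp only [Term.map, Term.vars, Set.image_iUnion, Set.image_union, Binders.range_map, ih]

theorem Term.freeVars_map (t : Term (L.sub F Q) W) :
    (t.map hι).freeVars = ι '' t.freeVars := by
  induction t with
  | var x => simp [Term.map, Term.freeVars]
  | app f xs ts ih =>
    simp only [Term.map, Term.freeVars, Set.image_iUnion, Set.image_sdiff hι, Binders.range_map, ih]

theorem Formula.vars_map (A : Formula (L.sub F Q) W) : (A.map hι).vars = ι '' A.vars := by
  induction A <;> simp only [Formula.map, Formula.vars, Set.image_iUnion, Set.image_union,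
    Binders.range_map, Term.vars_map, Set.image_empty, Set.image_singleton, *]

theorem Formula.freeVars_map (A : Formula (L.sub F Q) W) :
    (A.map hι).freeVars = ι '' A.freeVars := by
  induction A <;> simp only [Formula.map, Formula.freeVars, Set.image_iUnion, Set.image_union,
    Set.image_sdiff hι, Binders.range_map, Term.freeVars_map, Set.image_empty,
    Set.image_singleton, *]

theorem notMem_vars_map {t : Term (L.sub F Q) W} {x : W} (h : x ∉ t.vars) :
    ι x ∉ (t.map hι).vars := by
  rwa [Term.vars_map, hι.mem_set_image]

theorem Formula.notMem_vars_map {A : Formula (L.sub F Q) W} {x : W} (h : x ∉ A.vars) :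
    ι x ∉ (A.map hι).vars := by
  rwa [Formula.vars_map, hι.mem_set_image]

theorem restrict_map {θ : W → Term (L.sub F Q) W} {θ' : V → Term L V}
    (h : ∀ x, θ' (ι x) = (θ x).map hι) (S : Set W) (x : W) :
    restrict (ι '' S) θ' (ι x) = (restrict S θ x).map hι := by
  by_cases hx : x ∈ S
  · rw [restrict, restrict, if_pos hx, if_pos ⟨x, hx, rfl⟩, Term.map]
  · rw [restrict, restrict, if_neg hx, if_neg (by rwa [hι.mem_set_image]), h]

/-- Only the variables in the range of `ι` occur in the image, so `θ'` is constrained on that range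
alone. -/
theorem Term.graft_map (t : Term (L.sub F Q) W) : ∀ {θ : W → Term (L.sub F Q) W}
    {θ' : V → Term L V}, (∀ x, θ' (ι x) = (θ x).map hι) →
    (t.map hι).graft θ' = (t.graft θ).map hι := by
  induction t with
  | var x => intro θ θ' h; exact h x
  | app f xs ts ih =>
    intro θ θ' h
    simp only [Term.map, Term.graft]
    congr 1
    funext i
    refine ih i fun x => ?_
    rw [Binders.range_map]
    exact restrict_map hι h _ x

theorem Formula.graft_map (A : Formula (L.sub F Q) W) : ∀ {θ : W → Term (L.sub F Q) W}
    {θ' : V → Term L V}, (∀ x, θ' (ι x) = (θ x).map hι) →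
    (A.map hι).graft θ' = (A.graft θ).map hι := by
  induction A with
  | atom P xs ts =>
    intro θ θ' h
    simp only [Formula.map, Formula.graft]
    congr 1
    funext i
    refine (ts i).graft_map hι fun x => ?_
    rw [Binders.range_map]
    exact restrict_map hι h _ x
  | imp A B ihA ihB => intro θ θ' h; simp only [Formula.map, Formula.graft, ihA h, ihB h]
  | and A B ihA ihB => intro θ θ' h; simp only [Formula.map, Formula.graft, ihA h, ihB h]
  | or A B ihA ihB => intro θ θ' h; simp only [Formula.map, Formula.graft, ihA h, ihB h]
  | bot => intro θ θ' _; rfl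
  | all x A ih =>
    intro θ θ' h
    simp only [Formula.map, Formula.graft]
    rw [← Set.image_singleton, ih (restrict_map hι h {x})]
  | ex x A ih =>
    intro θ θ' h
    simp only [Formula.map, Formula.graft]
    rw [← Set.image_singleton, ih (restrict_map hι h {x})]

theorem renameMap_map {k : ℕ} {ys xs : Fin k → W} (hx : Function.Injective xs) (z : W) :
    (renameMap (fun j => ι (ys j)) (fun j => ι (xs j)) (ι z) : Term L V) =
      (renameMap ys xs z : Term (L.sub F Q) W).map hι := by
  by_cases hz : z ∈ Set.range xs
  · obtain ⟨j, rfl⟩ := hz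
    rw [renameMap_name ys hx, Term.map]
    exact renameMap_name (fun j => ι (ys j)) (hι.comp hx) j
  · rw [renameMap_of_notMem ys hz, Term.map, renameMap_of_notMem]
    rintro ⟨j, hj⟩
    exact hz ⟨j, hι hj⟩

theorem renameMap_vec_map (y x z : W) : (renameMap ![ι y] ![ι x] (ι z) : Term L V) =
    (renameMap ![y] ![x] z : Term (L.sub F Q) W).map hι := by
  by_cases hz : z = x
  · subst hz
    rw [renameMap_vec_self, renameMap_vec_self, Term.map]
  · rw [renameMap_vec_of_ne _ hz, renameMap_vec_of_ne _ (hι.ne hz), Term.map]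

theorem Term.Alpha.map {t t' : Term (L.sub F Q) W} (h : t.Alpha t') :
    (t.map hι).Alpha (t'.map hι) := by
  induction h with
  | var x => exact .var _
  | app f xs xs' ts ts' ys hy fresh h ih =>
    refine .app f.1 (xs.map hι) (xs'.map hι) _ _ (fun i j => ι (ys i j))
      (fun i => hι.comp (hy i)) (fun i j => ⟨notMem_vars_map hι (fresh i j).1,
        notMem_vars_map hι (fresh i j).2⟩) fun i => ?_
    exact (congrArg₂ Term.Alpha
      ((ts i).graft_map hι (renameMap_map hι (ys := ys i) (xs.injective i)))
      ((ts' i).graft_map hι (renameMap_map hι (ys := ys i) (xs'.injective i)))).mpr (ih i)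

theorem Formula.Alpha.map {A A' : Formula (L.sub F Q) W} (h : A.Alpha A') :
    (A.map hι).Alpha (A'.map hι) := by
  induction h with
  | atom P xs xs' ts ts' ys hy fresh h =>
    refine .atom P.1 (xs.map hι) (xs'.map hι) _ _ (fun i j => ι (ys i j))
      (fun i => hι.comp (hy i)) (fun i j => ⟨BindingLogic.notMem_vars_map hι (fresh i j).1,
        BindingLogic.notMem_vars_map hι (fresh i j).2⟩) fun i => ?_
    exact (congrArg₂ Term.Alpha
      ((ts i).graft_map hι (renameMap_map hι (ys := ys i) (xs.injective i)))
      ((ts' i).graft_map hι (renameMap_map hι (ys := ys i) (xs'.injective i)))).mpr ((h i).map hι)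
  | imp _ _ ihA ihB => exact .imp ihA ihB
  | and _ _ ihA ihB => exact .and ihA ihB
  | or _ _ ihA ihB => exact .or ihA ihB
  | bot => exact .bot
  | all x x' y A A' fresh h ih =>
    refine .all _ _ (ι y) _ _ ⟨Formula.notMem_vars_map hι fresh.1,
      Formula.notMem_vars_map hι fresh.2⟩ ?_
    rwa [A.graft_map hι (renameMap_vec_map hι y x), A'.graft_map hι (renameMap_vec_map hι y x')]
  | ex x x' y A A' fresh h ih =>
    refine .ex _ _ (ι y) _ _ ⟨Formula.notMem_vars_map hι fresh.1,
      Formula.notMem_vars_map hι fresh.2⟩ ?_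
    rwa [A.graft_map hι (renameMap_vec_map hι y x), A'.graft_map hι (renameMap_vec_map hι y x')]

theorem Term.IsSubst.map {t : Term (L.sub F Q) W} {x : W} {u u' : Term (L.sub F Q) W}
    (h : Term.IsSubst t x u u') : Term.IsSubst (t.map hι) (ι x) (u.map hι) (u'.map hι) := by
  induction h with
  | var_self => exact .var_self
  | var_other z h => exact .var_other _ (hι.ne h)
  | app f xs ys us us' fresh h ih =>
    refine .app f.1 (xs.map hι) (ys.map hι) _ _ (fun i j => ⟨notMem_vars_map hι (fresh i j).1,
      notMem_vars_map hι (fresh i j).2.1, hι.ne (fresh i j).2.2⟩) fun i => ?_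
    have e := (us i).graft_map hι (renameMap_map hι (ys := ys.name i) (xs.injective i))
    exact e ▸ ih i

theorem Formula.IsSubst.map {t : Term (L.sub F Q) W} {x : W} {A A' : Formula (L.sub F Q) W}
    (h : Formula.IsSubst t x A A') :
    Formula.IsSubst (t.map hι) (ι x) (A.map hι) (A'.map hι) := by
  induction h with
  | atom P xs ys us us' fresh h =>
    refine .atom P.1 (xs.map hι) (ys.map hι) _ _ (fun i j =>
      ⟨Formula.notMem_vars_map hι (fresh i j).1,
        BindingLogic.notMem_vars_map hι (fresh i j).2.1, hι.ne (fresh i j).2.2⟩) fun i => ?_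
    have e := (us i).graft_map hι (renameMap_map hι (ys := ys.name i) (xs.injective i))
    exact e ▸ (h i).map hι
  | imp _ _ ihA ihB => exact .imp ihA ihB
  | and _ _ ihA ihB => exact .and ihA ihB
  | or _ _ ihA ihB => exact .or ihA ihB
  | bot => exact .bot
  | all z y A A' fresh h ih =>
    refine .all _ (ι y) _ _ ⟨Formula.notMem_vars_map hι fresh.1,
      BindingLogic.notMem_vars_map hι fresh.2.1, hι.ne fresh.2.2⟩ ?_
    rwa [A.graft_map hι (renameMap_vec_map hι y z)]
  | ex z y A A' fresh h ih =>
    refine .ex _ (ι y) _ _ ⟨Formula.notMem_vars_map hι fresh.1,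
      BindingLogic.notMem_vars_map hι fresh.2.1, hι.ne fresh.2.2⟩ ?_
    rwa [A.graft_map hι (renameMap_vec_map hι y z)]

theorem rel_alpha_map {Γ Γ' : Multiset (Formula (L.sub F Q) W)}
    (h : Multiset.Rel Formula.Alpha Γ Γ') :
    Multiset.Rel Formula.Alpha (Γ.map (Formula.map hι)) (Γ'.map (Formula.map hι)) :=
  Multiset.rel_map.2 (h.mono fun _ _ _ _ h => h.map hι)

theorem notMem_freeVars_map {Γ : Multiset (Formula (L.sub F Q) W)} {x : W}
    (h : ∀ B ∈ Γ, x ∉ B.freeVars) : ∀ B ∈ Γ.map (Formula.map hι), ι x ∉ B.freeVars := by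
  intro B hB
  obtain ⟨A, hA, rfl⟩ := Multiset.mem_map.1 hB
  rw [Formula.freeVars_map, hι.mem_set_image]
  exact h A hA

/-- The derivation is translated rule by rule; injectivity of `ι` preserves all the freshness
conditions. -/
theorem Provable.map {Γ Δ : Multiset (Formula (L.sub F Q) W)} (h : Provable Γ Δ) :
    Provable (Γ.map (Formula.map hι)) (Δ.map (Formula.map hι)) := by
  induction h with
  | alpha hΓ hΔ _ ih => exact .alpha (rel_alpha_map hι hΓ) (rel_alpha_map hι hΔ) ih
  | ax A => simpa using Provable.ax (A.map hι)
  | cut A _ _ ih₁ ih₂ =>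
    rw [Multiset.map_cons] at ih₁ ih₂
    exact .cut _ ih₁ ih₂
  | contrLeft _ ih => simp only [Multiset.map_cons] at *; exact .contrLeft ih
  | contrRight _ ih => simp only [Multiset.map_cons] at *; exact .contrRight ih
  | weakLeft _ ih => simp only [Multiset.map_cons] at *; exact .weakLeft ih
  | weakRight _ ih => simp only [Multiset.map_cons] at *; exact .weakRight ih
  | impLeft _ _ ih₁ ih₂ => simp only [Multiset.map_cons] at *; exact .impLeft ih₁ ih₂
  | impRight _ ih => simp only [Multiset.map_cons] at *; exact .impRight ih
  | andLeft _ ih => simp only [Multiset.map_cons] at *; exact .andLeft ih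
  | andRight _ _ ih₁ ih₂ => simp only [Multiset.map_cons] at *; exact .andRight ih₁ ih₂
  | orLeft _ _ ih₁ ih₂ => simp only [Multiset.map_cons] at *; exact .orLeft ih₁ ih₂
  | orRight _ ih => simp only [Multiset.map_cons] at *; exact .orRight ih
  | botLeft => simp only [Multiset.map_cons]; exact .botLeft
  | allLeft t hs _ ih =>
    simp only [Multiset.map_cons] at *
    exact .allLeft (t.map hι) (hs.map hι) ih
  | allRight hΓ hΔ _ ih =>
    simp only [Multiset.map_cons] at *
    exact .allRight (notMem_freeVars_map hι hΓ) (notMem_freeVars_map hι hΔ) ih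
  | exLeft hΓ hΔ _ ih =>
    simp only [Multiset.map_cons] at *
    exact .exLeft (notMem_freeVars_map hι hΓ) (notMem_freeVars_map hι hΔ) ih
  | exRight t hs _ ih =>
    simp only [Multiset.map_cons] at *
    exact .exRight (t.map hι) (hs.map hι) ih

/-! ### Symbols of a proposition and preimages under the embedding. -/

/-- The function symbols of a term. -/
def Term.funcs : Term L V → Set L.Func
  | .var _ => ∅
  | .app f _ ts => {f} ∪ ⋃ i, (ts i).funcs

/-- The function symbols of a proposition. -/
def Formula.funcs : Formula L V → Set L.Func
  | .atom _ _ ts => ⋃ i, (ts i).funcs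
  | .imp A B => A.funcs ∪ B.funcs
  | .and A B => A.funcs ∪ B.funcs
  | .or A B => A.funcs ∪ B.funcs
  | .bot => ∅
  | .all _ A => A.funcs
  | .ex _ A => A.funcs

/-- The predicate symbols of a proposition. -/
def Formula.preds : Formula L V → Set L.Pred
  | .atom P _ _ => {P}
  | .imp A B => A.preds ∪ B.preds
  | .and A B => A.preds ∪ B.preds
  | .or A B => A.preds ∪ B.preds
  | .bot => ∅
  | .all _ A => A.preds
  | .ex _ A => A.preds

theorem Term.finite_funcs (t : Term L V) : t.funcs.Finite := by
  induction t with
  | var x => exact Set.finite_empty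
  | app f xs ts ih => exact (Set.finite_singleton f).union (Set.finite_iUnion ih)

theorem Formula.finite_funcs (A : Formula L V) : A.funcs.Finite := by
  induction A with
  | atom P xs ts => exact Set.finite_iUnion fun i => (ts i).finite_funcs
  | imp A B ihA ihB => exact ihA.union ihB
  | and A B ihA ihB => exact ihA.union ihB
  | or A B ihA ihB => exact ihA.union ihB
  | bot => exact Set.finite_empty
  | all x A ih => exact ih
  | ex x A ih => exact ih

theorem Formula.finite_preds (A : Formula L V) : A.preds.Finite := by
  induction A with
  | atom P xs ts => exact Set.finite_singleton P
  | imp A B ihA ihB => exact ihA.union ihB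
  | and A B ihA ihB => exact ihA.union ihB
  | or A B ihA ihB => exact ihA.union ihB
  | bot => exact Set.finite_empty
  | all x A ih => exact ih
  | ex x A ih => exact ih

theorem Binders.exists_map_eq {k : List ℕ} (xs : Binders k V)
    (h : ∀ i, Set.range (xs.name i) ⊆ Set.range ι) : ∃ ys : Binders k W, ys.map hι = xs := by
  choose g hg using fun i j => h i ⟨j, rfl⟩
  refine ⟨⟨g, fun a b e => xs.distinct ?_⟩, ?_⟩
  · have e : g a.1 a.2 = g b.1 b.2 := e
    change xs.name a.1 a.2 = xs.name b.1 b.2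
    rw [← hg, ← hg, e]
  · cases xs
    simp only [Binders.map, hg]

theorem Term.exists_map_eq (t : Term L V) (hF : t.funcs ⊆ F) (hV : t.vars ⊆ Set.range ι) :
    ∃ s : Term (L.sub F Q) W, s.map hι = t := by
  induction t with
  | var x =>
    obtain ⟨y, rfl⟩ := hV rfl
    exact ⟨.var y, rfl⟩
  | app f xs ts ih =>
    have hf : f ∈ F := hF (Or.inl rfl)
    obtain ⟨ys, hys⟩ := xs.exists_map_eq hι fun i =>
      subset_trans (fun x hx => Set.mem_iUnion.2 ⟨i, Or.inl hx⟩) hV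
    choose ss hss using fun i => ih i
      (subset_trans (fun x hx => Or.inr (Set.mem_iUnion.2 ⟨i, hx⟩)) hF)
      (subset_trans (fun x hx => Set.mem_iUnion.2 ⟨i, Or.inr hx⟩) hV)
    exact ⟨.app ⟨f, hf⟩ ys ss, congrArg₂ (Term.app f) hys (funext hss)⟩

theorem Formula.exists_map_eq (A : Formula L V) (hF : A.funcs ⊆ F) (hQ : A.preds ⊆ Q)
    (hV : A.vars ⊆ Set.range ι) : ∃ B : Formula (L.sub F Q) W, B.map hι = A := by
  induction A with
  | atom P xs ts =>
    have hP : P ∈ Q := hQ rfl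
    obtain ⟨ys, hys⟩ := xs.exists_map_eq hι fun i =>
      subset_trans (fun x hx => Set.mem_iUnion.2 ⟨i, Or.inl hx⟩) hV
    choose ss hss using fun i => (ts i).exists_map_eq (Q := Q) hι
      (subset_trans (fun x hx => Set.mem_iUnion.2 ⟨i, hx⟩) hF)
      (subset_trans (fun x hx => Set.mem_iUnion.2 ⟨i, Or.inr hx⟩) hV)
    exact ⟨.atom ⟨P, hP⟩ ys ss, congrArg₂ (Formula.atom P) hys (funext hss)⟩
  | imp A B ihA ihB =>
    obtain ⟨A', rfl⟩ := ihA (fun _ h => hF (.inl h)) (fun _ h => hQ (.inl h)) fun _ h => hV (.inl h)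
    obtain ⟨B', rfl⟩ := ihB (fun _ h => hF (.inr h)) (fun _ h => hQ (.inr h)) fun _ h => hV (.inr h)
    exact ⟨.imp A' B', rfl⟩
  | and A B ihA ihB =>
    obtain ⟨A', rfl⟩ := ihA (fun _ h => hF (.inl h)) (fun _ h => hQ (.inl h)) fun _ h => hV (.inl h)
    obtain ⟨B', rfl⟩ := ihB (fun _ h => hF (.inr h)) (fun _ h => hQ (.inr h)) fun _ h => hV (.inr h)
    exact ⟨.and A' B', rfl⟩
  | or A B ihA ihB =>
    obtain ⟨A', rfl⟩ := ihA (fun _ h => hF (.inl h)) (fun _ h => hQ (.inl h)) fun _ h => hV (.inl h)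
    obtain ⟨B', rfl⟩ := ihB (fun _ h => hF (.inr h)) (fun _ h => hQ (.inr h)) fun _ h => hV (.inr h)
    exact ⟨.or A' B', rfl⟩
  | bot => exact ⟨.bot, rfl⟩
  | all x A ih =>
    obtain ⟨y, rfl⟩ := hV (Or.inl rfl)
    obtain ⟨A', rfl⟩ := ih hF hQ fun _ h => hV (.inr h)
    exact ⟨.all y A', rfl⟩
  | ex x A ih =>
    obtain ⟨y, rfl⟩ := hV (Or.inl rfl)
    obtain ⟨A', rfl⟩ := ih hF hQ fun _ h => hV (.inr h)
    exact ⟨.ex y A', rfl⟩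

theorem exists_multiset_map_eq {Γ : Multiset (Formula L V)}
    (h : ∀ A ∈ Γ, A.funcs ⊆ F ∧ A.preds ⊆ Q ∧ A.vars ⊆ Set.range ι) :
    ∃ Γ' : Multiset (Formula (L.sub F Q) W), Γ'.map (Formula.map hι) = Γ := by
  induction Γ using Multiset.induction_on with
  | empty => exact ⟨0, rfl⟩
  | cons A Γ ih =>
    obtain ⟨Γ', rfl⟩ := ih fun B hB => h B (Multiset.mem_cons_of_mem hB)
    obtain ⟨hF, hQ, hV⟩ := h A (Multiset.mem_cons_self _ _)
    obtain ⟨A', rfl⟩ := A.exists_map_eq hι hF hQ hV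
    exact ⟨A' ::ₘ Γ', Multiset.map_cons _ _ _⟩

/-! ### Expansion of a model of the sublanguage. -/

open scoped Classical in
/-- The expansion of a model of a sublanguage, where the other function symbols denote a constant
and the other predicate symbols are false. -/
noncomputable abbrev BindingModel.expand (M : BindingModel.{u, v} (L.sub F Q))
    (c : M.carrier 0) : BindingModel.{u, v} L where
  toIntensionalStructure := M.toIntensionalStructure
  func f p a := if h : f ∈ F then M.func ⟨f, h⟩ p a else M.comp c Fin.elim0
  func_comp f p q a b := by
    by_cases h : f ∈ F
    · rw [dif_pos h, dif_pos h]
      exact M.func_comp ⟨f, h⟩ p q a b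
    -- The constant comes from level `0`, so composing it with `b` leaves only a tuple of length
    -- `0`, and all such tuples are equal.
    · rw [dif_neg h, dif_neg h, M.comp_assoc]
      congr 1
      exact Subsingleton.elim _ _
  pred P a := ∃ h : P ∈ Q, M.pred ⟨P, h⟩ a

variable (M : BindingModel.{u, v} (L.sub F Q)) (c : M.carrier 0)

theorem BindingModel.ext_expand (hι : Function.Injective ι) {p k : ℕ} (ρ : V → M.carrier p) {ys : Fin k → W}
    (hy : Function.Injective ys) (x : W) :
    (M.expand c).ext ρ (fun j => ι (ys j)) (ι x) = M.ext (fun z => ρ (ι z)) ys x := by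
  by_cases hx : x ∈ Set.range ys
  · obtain ⟨j, rfl⟩ := hx
    rw [M.ext_name _ hy]
    exact (M.expand c).ext_name ρ (hι.comp hy) j
  · rw [M.ext_of_notMem _ hx, BindingModel.ext_of_notMem]
    rintro ⟨j, hj⟩
    exact hx ⟨j, hι hj⟩

theorem BindingModel.eval_expand (t : Term (L.sub F Q) W) : ∀ {p : ℕ} (ρ : V → M.carrier p),
    (M.expand c).eval (t.map hι) ρ = M.eval t fun x => ρ (ι x) := by
  induction t with
  | var x => intro p ρ; rfl
  | app f xs ts ih =>
    intro p ρ
    simp only [BindingModel.eval, Term.map]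
    rw [dif_pos f.2]
    congr 1
    funext i
    rw [ih i]
    congr 1
    funext x
    exact M.ext_expand c hι ρ (xs.injective i) x

theorem BindingModel.sat_expand (A : Formula (L.sub F Q) W) : ∀ φ : V → M.carrier 0,
    (M.expand c).Sat φ (A.map hι) ↔ M.Sat (fun x => φ (ι x)) A := by
  classical
  have upd : ∀ (φ : V → M.carrier 0) (x : W) (a : M.carrier 0),
      (fun z => Function.update φ (ι x) a (ι z)) = Function.update (fun z => φ (ι z)) x a := by
    intro φ x a
    exact Function.update_comp_eq_of_injective φ hι x a
  induction A with
  | atom P xs ts =>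
    intro φ
    rw [Formula.map, BindingModel.sat_atom, BindingModel.sat_atom]
    have e : ∀ i, (M.expand c).eval ((ts i).map hι) ((M.expand c).ext φ ((xs.map hι).name i)) =
        M.eval (ts i) (M.ext (fun x => φ (ι x)) (xs.name i)) := by
      intro i
      rw [M.eval_expand hι c (ts i)]
      congr 1
      funext x
      exact M.ext_expand c hι φ (xs.injective i) x
    have e := funext e
    constructor
    · rintro ⟨_, h⟩
      rw [← e]
      exact h
    · intro h
      refine ⟨P.2, ?_⟩
      rw [← e] at h
      exact h
  | imp A B ihA ihB => exact fun φ => imp_congr (ihA φ) (ihB φ)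
  | and A B ihA ihB => exact fun φ => and_congr (ihA φ) (ihB φ)
  | or A B ihA ihB => exact fun φ => or_congr (ihA φ) (ihB φ)
  | bot => exact fun φ => Iff.rfl
  | all x A ih =>
    refine fun φ => forall_congr' fun a => ?_
    rw [← upd]
    exact ih _
  | ex x A ih =>
    refine fun φ => exists_congr fun a => ?_
    rw [← upd]
    exact ih _

end Sublanguage

/-! ### Countermodels over an arbitrary language. -/

section Completeness

variable {L : Language.{u}} {V : Type w}

/-- A countably infinite set of variables is adjoined to `S`. `ULift` serves to place the
countermodel in the required universe. -/
theorem exists_injective_range_superset [Infinite V] {S : Set V} (hS : S.Finite) :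
    ∃ ι : ULift.{v} ℕ → V, Function.Injective ι ∧ S ⊆ Set.range ι := by
  have hC : (S ∪ Set.range (Infinite.natEmbedding V)).Countable :=
    hS.countable.union (Set.countable_range _)
  have hI : (S ∪ Set.range (Infinite.natEmbedding V)).Infinite :=
    (Set.infinite_range_of_injective (Infinite.natEmbedding V).injective).mono
      Set.subset_union_right
  have := hC.to_subtype
  have := hI.to_subtype
  obtain ⟨e⟩ := nonempty_equiv_of_countable (α := ULift.{v} ℕ)
    (β := ↥(S ∪ Set.range (Infinite.natEmbedding V)))
  refine ⟨fun n => (e n).1, Subtype.val_injective.comp e.injective, fun x hx => ?_⟩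
  exact ⟨e.symm ⟨x, Or.inl hx⟩, by simp⟩

/-- An unprovable sequent has a countermodel. -/
theorem exists_countermodel [Infinite V] {Γ Δ : Multiset (Formula L V)} (h : ¬ Provable Γ Δ) :
    ∃ (M : BindingModel.{u, max u v w} L) (φ : V → M.carrier 0),
      (∀ A ∈ Γ, M.Sat φ A) ∧ ∀ B ∈ Δ, ¬ M.Sat φ B := by
  obtain ⟨F, hF, hFs⟩ : ∃ F : Set L.Func, F.Finite ∧ ∀ A ∈ Γ + Δ, A.funcs ⊆ F :=
    ⟨⋃ A ∈ {A | A ∈ Γ + Δ}, A.funcs,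
      Set.Finite.biUnion (Multiset.finite_toSet _) fun A _ => A.finite_funcs,
      fun A hA => Set.subset_biUnion_of_mem (u := fun A : Formula L V => A.funcs) hA⟩
  obtain ⟨Q, hQ, hQs⟩ : ∃ Q : Set L.Pred, Q.Finite ∧ ∀ A ∈ Γ + Δ, A.preds ⊆ Q :=
    ⟨⋃ A ∈ {A | A ∈ Γ + Δ}, A.preds,
      Set.Finite.biUnion (Multiset.finite_toSet _) fun A _ => A.finite_preds,
      fun A hA => Set.subset_biUnion_of_mem (u := fun A : Formula L V => A.preds) hA⟩
  obtain ⟨ι, hι, hr⟩ := exists_injective_range_superset.{max v w} (finite_vars_multiset (Γ + Δ))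
  have hsub : ∀ A ∈ Γ + Δ, A.funcs ⊆ F ∧ A.preds ⊆ Q ∧ A.vars ⊆ Set.range ι := fun A hA =>
    ⟨hFs A hA, hQs A hA, fun x hx => hr ⟨A, hA, hx⟩⟩
  obtain ⟨Γ', rfl⟩ := exists_multiset_map_eq hι fun A hA =>
    hsub A (Multiset.mem_add.2 (Or.inl hA))
  obtain ⟨Δ', rfl⟩ := exists_multiset_map_eq hι fun A hA =>
    hsub A (Multiset.mem_add.2 (Or.inr hA))
  have hp : ¬ Provable Γ' Δ' := fun h' => h (h'.map hι)
  have : Countable (L.sub F Q).Func := hF.countable.to_subtype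
  have : Countable (L.sub F Q).Pred := hQ.countable.to_subtype
  obtain ⟨T, T', hT, hΓ, hΔ⟩ := exists_isHenkin hp
  let M := DeBruijn.model (L.sub F Q) (ULift.{max v w} ℕ) (termInterpretation T)
  -- Variables outside the range of `ι` receive an arbitrary name; they do not occur in the sequent.
  let φ : V → M.carrier 0 := fun x => DeBruijn.free (Function.invFun ι x)
  have hφ : (fun x => φ (ι x)) = DeBruijn.free :=
    funext fun x => congrArg DeBruijn.free (Function.leftInverse_invFun hι x)
  refine ⟨M.expand (DeBruijn.free ⟨0⟩), φ, fun A hA => ?_, fun B hB => ?_⟩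
  · obtain ⟨A, hA', rfl⟩ := Multiset.mem_map.1 hA
    rw [M.sat_expand hι _ A φ, hφ]
    exact (hT.sat A).1 (hΓ A hA')
  · obtain ⟨B, hB', rfl⟩ := Multiset.mem_map.1 hB
    rw [M.sat_expand hι _ B φ, hφ]
    exact (hT.sat B).2 (hΔ B hB')

theorem BindingModel.valid_iff_sat (M : BindingModel.{u, v} L) {A : Formula L V}
    (hA : A.freeVars = ∅) (φ : V → M.carrier 0) : M.Valid A ↔ M.Sat φ A :=
  ⟨fun h => h φ, fun h ψ => (M.sat_congr A (by simp [hA])).1 h⟩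

end Completeness

end BindingLogic

theorem mainTheorem1 (L : BindingLogic.Language.{u}) (V : Type w) [Infinite V]
    (Γ Δ : Multiset (BindingLogic.Formula L V)) :
    (BindingLogic.Provable Γ Δ ↔
      ∀ (M : BindingLogic.BindingModel.{u, max u v w} L) (φ : V → M.carrier 0),
        (∀ A ∈ Γ, M.Sat φ A) → ∃ B ∈ Δ, M.Sat φ B) ∧
    ((∀ A ∈ Γ + Δ, A.freeVars = ∅) →
      (BindingLogic.Provable Γ Δ ↔
        ∀ M : BindingLogic.BindingModel.{u, max u v w} L, Nonempty (M.carrier 0) →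
          (∀ A ∈ Γ, M.Valid A) → ∃ B ∈ Δ, M.Valid B)) := by
  have main : BindingLogic.Provable Γ Δ ↔
      ∀ (M : BindingLogic.BindingModel.{u, max u v w} L) (φ : V → M.carrier 0),
        (∀ A ∈ Γ, M.Sat φ A) → ∃ B ∈ Δ, M.Sat φ B := by
    refine ⟨fun h M φ => h.sound M φ, fun h => ?_⟩
    by_contra hp
    obtain ⟨M, φ, hΓ, hΔ⟩ := BindingLogic.exists_countermodel.{u, v, w} hp
    obtain ⟨B, hB, hs⟩ := h M φ hΓ
    exact hΔ B hB hs
  refine ⟨main, fun hc => main.trans ⟨fun h M hM hΓ => ?_, fun h M φ hΓ => ?_⟩⟩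
  · obtain ⟨a⟩ := hM
    obtain ⟨B, hB, hs⟩ := h M (fun _ => a) fun A hA => hΓ A hA _
    exact ⟨B, hB, (M.valid_iff_sat (hc B (Multiset.mem_add.2 (Or.inr hB))) _).2 hs⟩
  -- An assignment on a nonempty set of variables already shows that `M_0` is nonempty.
  · obtain ⟨x⟩ := (inferInstance : Nonempty V)
    obtain ⟨B, hB, hs⟩ := h M ⟨φ x⟩ fun A hA =>
      (M.valid_iff_sat (hc A (Multiset.mem_add.2 (Or.inl hA))) φ).2 (hΓ A hA)
    exact ⟨B, hB, hs φ⟩
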